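/- Let $f,g\in\mathbb Z[x]$ be irreducible over $\mathbb Q$, of the same degree $n$, with leading coefficients $f_n,g_n$; let $\alpha,\beta$ denote roots of $f,g$, $\mathbb Q(\alpha)=\mathbb Q[x]/(f)$, $\mathrm{Base}_i=\alpha^{i-1}/f'(\alpha)$ ($1\le i\le n$). Let $S>0$ be any real upper bound for $\sum_{g(\gamma)=0}|\gamma|$ (complex roots) and $b:=nS\|f\|$, where $\|f\|$ is the Euclidean norm of the coefficient vector. For $e\in\mathbb N$ put $a(e):=\lceil b^{e/10}2^{e/4}\rceil$. A prime is good if it divides neither $f_ng_n$ nor the discriminants of $f$ and $g$. For a prime $p$ let $F_d$ (resp. $G_d$) be the product of the irreducible factors of degree $d$ of $f$ (resp. $g$) in $\mathbb Q_p[x]$, let $m$ be the number of $d$ with $\deg F_d>0$, and for $h\in\mathbb Q[x]$ with $\deg h<n$ let $Tr_p^d(f,h(\alpha))=\sum_{F_d(\gamma)=0}h(\gamma)$ (roots in $\overline{\mathbb Q}_p$); likewise for $g$. We say that the patterns match at $p$ if $\deg F_d=\deg G_d$ for all $d$. LLL-with-removals, applied to an integer matrix $A$ and $b$, returns an LLL-reduced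 basis (parameter $3/4$) of a lattice obtained from the row lattice of $A$ by removing, zero or more times, the last vector of some basis when its Gram–Schmidt length exceeds $b$, such that the last Gram–Schmidt length of the result (if it is nonempty) is at most $b$. To *reduce* an integer matrix $C$ with $n+1$ columns against $T\in\mathbb Z^{(n+1)\times m}$ modulo $p^a$ means: if $CT\equiv0\bmod p^a$, keep $C$; otherwise put $A=\begin{pmatrix}C&CT\\0&p^aI_m\end{pmatrix}$, compute $(C',B)=$ LLL-with-removals$(A,b)$ and, as long as $B\ne0$, replace $B$ by $10^{20}B$ and apply LLL-with-removals to $(C',B)$ again; when $B=0$, return $C'$. If a matrix has at most one row, its *outcome* is: no isomorphism if it has no row; and if its row is $(V,v)$, the map $\beta\mapsto-\frac1v\sum_iV_i\mathrm{Base}_i$ if $v\neq0$ and this element is a root of $g$, and no isomorphism otherwise. **Pre-Processing.** Start with $C=I_{n+1}$, and run through the primes $p>3$ in increasing order, skipping those that are not good. If $m=1$ go to the next prime, but return $C$ as soon as more than 25 good primes with $m=1$ have been met since the last prime with $m\ne1$ (or since the start). If $m\neq1$ and the patterns do not match at $p$, stop: there is no isomorphism. Otherwise store $p$ if $\deg F_1>0$,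 let $e$ be the number of rows of $C$, $a=a(e)$, and let $T$ be the matrix with one column for each $d$ with $\deg F_d>0$, with entries $Tr_p^d(f,\mathrm{Base}_1),\dots,Tr_p^d(f,\mathrm{Base}_n),Tr_p^d(g,\beta)$ modulo $p^a$. If $CT\equiv0\bmod p^a$, go to the next prime, unless this happens for the tenth time, in which case return $C$. If not, reduce $C$ against $T$ modulo $p^a$; if the result has at most one row, stop with its outcome, otherwise go to the next prime. **FindIsomorphism.** (1) Run Pre-Processing; continue if it returns a matrix $C$. (2) If a prime was stored, choose a stored $p$ with smallest $\deg F_1$; otherwise run through the following good primes until one has $\deg F_1>0$ (stopping with "no isomorphism" if the patterns do not match at a prime that is tested). (3) Let $\alpha_1,\dots,\alpha_d$ be the roots of $F_1$ in $\mathbb Q_p$, $\beta_1$ a root of $G_1$, and $a=a(e)$ with $e$ the number of rows of $C$. (4) For $j=1,\dots,d$, starting each time from the matrix $C$ returned by Pre-Processing: reduce the current matrix modulo $p^a$ against the column $(\mathrm{Base}_1|_{\alpha=\alpha_j},\dots,\mathrm{Base}_n|_{\alpha=\alpha_j},\beta_1)^T$; while the result has more than one row, replace $a$ by $2a$ and reduce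 again; when it has at most one row, record its outcome and go on to the next $j$. Then FindIsomorphism terminates: whatever choices are made (outputs of LLL-with-removals, residues, numbering of the roots, choice of $\beta_1$ and of $p$), every step that has to be carried out before the algorithm has stopped can be carried out, and there is no infinite run. -/

import Mathlib

open Polynomial

namespace FindIso

noncomputable section

/-! ### Number fields, the rational representation basis, bounds -/

/-- `f` viewed in `ℚ[x]`. -/
abbrev toQ (f : ℤ[X]) : ℚ[X] := f.map (Int.castRingHom ℚ)

/-- `ℚ(α) = ℚ[x]/(f)`; the element `α` is `AdjoinRoot.root (toQ f)`. -/
abbrev NF (f : ℤ[X]) : Type := AdjoinRoot (toQ f)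

/-- The map `ρ : (a_0, …, a_{n-1}) ↦ (∑ a_i α^i) / f'(α)`. -/
def rho (f : ℤ[X]) [Fact (Irreducible (toQ f))] (a : Fin f.natDegree → ℚ) : NF f :=
  (∑ i, algebraMap ℚ (NF f) (a i) * AdjoinRoot.root (toQ f) ^ (i : ℕ)) /
    aeval (AdjoinRoot.root (toQ f)) (derivative f)

/-- The rational representation basis `α^i / f'(α)`, `0 ≤ i < n`. -/
def base (f : ℤ[X]) [Fact (Irreducible (toQ f))] (i : Fin f.natDegree) : NF f :=
  rho f (Pi.single i 1)

/-- The polynomial `h(x) ∈ ℚ[x]_{<n}` that represents an element `h(α)` of `ℚ(α)`. -/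
def rep (f : ℤ[X]) (z : NF f) : ℚ[X] :=
  Function.surjInv AdjoinRoot.mk_surjective z % toQ f

/-- The 2-norm of the coefficient vector of `f`. -/
def coeffNorm (f : ℤ[X]) : ℝ := √(∑ i ∈ f.support, (f.coeff i : ℝ) ^ 2)

/-- The sum of the absolute values of the complex roots of `g`. -/
def rootSum (g : ℤ[X]) : ℝ := ((g.aroots ℂ).map (fun z => ‖z‖)).sum

/-- The bound `b = n S ‖f‖`. -/
def bound (f : ℤ[X]) (S : ℝ) : ℝ := f.natDegree * S * coeffNorm f

/-- The exponent `a = ⌈b^(e/10) 2^(e/4)⌉` of the precision `p^a`. -/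
def precision (b : ℝ) (e : ℕ) : ℕ := ⌈b ^ ((e : ℝ) / 10) * 2 ^ ((e : ℝ) / 4)⌉₊

/-! ### Local factorizations and sub-traces -/

instance factPrimes (p : Nat.Primes) : Fact (p : ℕ).Prime := ⟨p.2⟩

/-- A good prime: it divides neither a leading coefficient nor a discriminant. -/
def IsGood (f g : ℤ[X]) (p : Nat.Primes) : Prop :=
  ¬ ((p : ℕ) : ℤ) ∣ f.leadingCoeff ∧ ¬ ((p : ℕ) : ℤ) ∣ g.leadingCoeff ∧
    ¬ ((p : ℕ) : ℤ) ∣ f.discr ∧ ¬ ((p : ℕ) : ℤ) ∣ g.discr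

open Classical in
/-- `F_d`: the product of the irreducible factors of `f` in `ℚ_p[x]` of degree `d`. -/
def ddFactor (p : Nat.Primes) (f : ℤ[X]) (d : ℕ) : ℚ_[(p : ℕ)][X] :=
  ((UniqueFactorizationMonoid.normalizedFactors
    (f.map (Int.castRingHom ℚ_[(p : ℕ)]))).filter (fun P => P.natDegree = d)).prod

/-- The degrees `d` with `deg F_d > 0`. -/
def ddDegrees (p : Nat.Primes) (f : ℤ[X]) : Set ℕ := {d | 0 < (ddFactor p f d).natDegree}

/-- The distinct degree factorizations of `f` and `g` have the same shape. -/
def SameShape (f g : ℤ[X]) (p : Nat.Primes) : Prop :=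
  ∀ d, (ddFactor p f d).natDegree = (ddFactor p g d).natDegree

/-- The sub-trace `Tr_p^d(f, z)`: the sum of `h(γ)` over the roots `γ` of `F_d` in an algebraic
closure of `ℚ_p`, where `z = h(α)`. (For a good prime the roots are simple and the sum lies in
`ℚ_p`.) -/
def subTrace (p : Nat.Primes) (f : ℤ[X]) (d : ℕ) (z : NF f) : AlgebraicClosure ℚ_[(p : ℕ)] :=
  (((ddFactor p f d).aroots (AlgebraicClosure ℚ_[(p : ℕ)])).map
    (fun γ => aeval γ (rep f z))).sum

/-- `s` is a `p`-adic integer and the integer `t` is congruent to it modulo `p^a`. -/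
def IsResidue (p : Nat.Primes) (a : ℕ) {K : Type} [Field K] [Algebra ℚ_[(p : ℕ)] K]
    (s : K) (t : ℤ) : Prop :=
  ∃ z : ℤ_[(p : ℕ)], algebraMap ℚ_[(p : ℕ)] K (z : ℚ_[(p : ℕ)]) = s ∧
    (t : ZMod ((p : ℕ) ^ a)) = PadicInt.toZModPow a z

/-- `T` is (an integer matrix congruent modulo `p^a` to) the matrix of sub-traces: one column for
each degree `d` occurring in the distinct degree factorization, the first `n` rows for the basis
elements of `ℚ(α)`, the last row for `β`. -/
def IsTraceMatrix (f g : ℤ[X]) [Fact (Irreducible (toQ f))] (p : Nat.Primes) (a : ℕ) {m : ℕ}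
    (T : Matrix (Fin (f.natDegree + 1)) (Fin m) ℤ) : Prop :=
  ∃ ds : Fin m → ℕ, StrictMono ds ∧ Set.range ds = ddDegrees p f ∧ ∀ j,
    (∀ i, IsResidue p a (subTrace p f (ds j) (base f i)) (T i.castSucc j)) ∧
    IsResidue p a (subTrace p g (ds j) (AdjoinRoot.root (toQ g))) (T (Fin.last _) j)

/-- `T` is (an integer column congruent modulo `p^a` to) the column of the values of the basis
elements at the root `x ∈ ℚ_p` of `f`, followed by the root `y ∈ ℚ_p` of `g`. -/
def IsRootMatrix (f : ℤ[X]) [Fact (Irreducible (toQ f))] (p : Nat.Primes) (a : ℕ)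
    (x y : ℚ_[(p : ℕ)]) (T : Matrix (Fin (f.natDegree + 1)) (Fin 1) ℤ) : Prop :=
  (∀ i, IsResidue p a (aeval x (rep f (base f i))) (T i.castSucc 0)) ∧
    IsResidue p a y (T (Fin.last _) 0)

/-! ### Lattice reduction -/

section LLL

variable {ι : Type} [Fintype ι]

/-- The lattice spanned by the rows of an integer matrix. -/
def rowLattice {κ : Type} (A : Matrix κ ι ℤ) : Submodule ℤ (ι → ℤ) :=
  Submodule.span ℤ (Set.range A.row)

/-- A row, as a vector of Euclidean space. -/
def rowVec {k : ℕ} (L : Matrix (Fin k) ι ℤ) (i : Fin k) : EuclideanSpace ℝ ι :=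
  WithLp.toLp 2 (fun j => (L i j : ℝ))

/-- The Gram-Schmidt vectors `b_i*` of the rows. -/
def gs {k : ℕ} (L : Matrix (Fin k) ι ℤ) : Fin k → EuclideanSpace ℝ ι :=
  InnerProductSpace.gramSchmidt ℝ (rowVec L)

/-- The Gram-Schmidt coefficients `μ_{ij} = ⟨b_i, b_j*⟩ / ⟨b_j*, b_j*⟩`. -/
def mu {k : ℕ} (L : Matrix (Fin k) ι ℤ) (i j : Fin k) : ℝ :=
  inner ℝ (gs L j) (rowVec L i) / ‖gs L j‖ ^ 2

/-- LLL-reduced bases: linearly independent rows, size-reduced, with the Lovász condition. -/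
structure IsLLLReduced {k : ℕ} (L : Matrix (Fin k) ι ℤ) : Prop where
  indep : LinearIndependent ℤ L.row
  size : ∀ i j, j < i → |mu L i j| ≤ 1 / 2
  lovasz : ∀ i j : Fin k, (j : ℕ) + 1 = i →
    3 / 4 * ‖gs L j‖ ^ 2 ≤ ‖gs L i + mu L i j • gs L j‖ ^ 2

/-- One removal: the last vector of a basis of a lattice is dropped because its Gram-Schmidt length
exceeds `b`. -/
inductive Removal (b : ℝ) : Submodule ℤ (ι → ℤ) → Submodule ℤ (ι → ℤ) → Prop
  | mk {k : ℕ} (M : Matrix (Fin (k + 1)) ι ℤ) (indep : LinearIndependent ℤ M.row)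
      (large : b < ‖gs M (Fin.last k)‖) :
      Removal b (rowLattice M) (rowLattice (M.submatrix Fin.castSucc id))

/-- `L` is a possible output of LLL-with-removals on the lattice spanned by the rows of `A`: any
number of removals take place, and the result is an LLL-reduced basis whose last vector (if any) has
Gram-Schmidt length at most `b`. -/
def LLLWithRemovals (b : ℝ) {κ : Type} (A : Matrix κ ι ℤ) {k : ℕ} (L : Matrix (Fin k) ι ℤ) :
    Prop :=
  Relation.ReflTransGen (Removal b) (rowLattice A) (rowLattice L) ∧ IsLLLReduced L ∧
    ∀ i : Fin k, (i : ℕ) + 1 = k → ‖gs L i‖ ≤ b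

end LLL

/-- The matrix `[[C, C T], [0, p^a I]]`. -/
def augment {n e m : ℕ} (C : Matrix (Fin e) (Fin n) ℤ) (T : Matrix (Fin n) (Fin m) ℤ) (q : ℤ) :
    Matrix (Fin (e + m)) (Fin n ⊕ Fin m) ℤ :=
  (Matrix.fromBlocks C (C * T) 0 (q • (1 : Matrix (Fin m) (Fin m) ℤ))).submatrix
    finSumFinEquiv.symm id

/-- `C T ≡ 0` modulo `q`. -/
def Vanishes {n e m : ℕ} (C : Matrix (Fin e) (Fin n) ℤ) (T : Matrix (Fin n) (Fin m) ℤ) (q : ℤ) :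
    Prop :=
  ∀ i j, q ∣ (C * T) i j

/-- `[C, B]` becomes `[C, 10^20 B]`. -/
def scale {k n m : ℕ} (L : Matrix (Fin k) (Fin n ⊕ Fin m) ℤ) :
    Matrix (Fin k) (Fin n ⊕ Fin m) ℤ :=
  Matrix.fromCols L.toCols₁ ((10 ^ 20 : ℤ) • L.toCols₂)

/-! ### The algorithm as a transition system -/

/-- The element `h(α)` read off from a relation `(V, v)`, i.e. from
`∑ V_i α^i / f'(α) + v h(α) = 0`. -/
def isoOf (f : ℤ[X]) [Fact (Irreducible (toQ f))] (r : Fin (f.natDegree + 1) → ℤ) : NF f :=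
  rho f (fun i => -(r i.castSucc : ℚ) / (r (Fin.last _) : ℚ))

open Classical in
/-- The isomorphisms (given by the image of `β`) output for a lattice with at most one generator:
none if there is no generator, and the verified candidate if there is one. -/
def outcome (f g : ℤ[X]) [Fact (Irreducible (toQ f))] :
    (e : ℕ) → Matrix (Fin e) (Fin (f.natDegree + 1)) ℤ → List (NF f)
  | 1, C => if C 0 (Fin.last _) ≠ 0 ∧ aeval (isoOf f (C 0)) g = 0 then [isoOf f (C 0)] else []
  | _, _ => []

/-- Variables of Pre-Processing: the last prime tried, the number of times that `C T ≡ 0` was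
met, and the primes stored for later use. -/
structure PreData where
  p : ℕ
  cnt : ℕ
  stored : List Nat.Primes

/-- Variables of the loop over the roots `α_j`: the prime, the roots of `F_1` still to be treated
(the first one is the current `α_j`), the chosen root `β_1` of `G_1`, the current exponent `a` of
the precision, the lattice that Pre-Processing returned, and the isomorphisms found so far. -/
structure LoopData (f : ℤ[X]) where
  p : Nat.Primes
  roots : List ℚ_[(p : ℕ)]
  y : ℚ_[(p : ℕ)]
  a : ℕ
  e₀ : ℕ
  C₀ : Matrix (Fin e₀) (Fin (f.natDegree + 1)) ℤ
  out : List (NF f)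

/-- Configurations of FindIsomorphism. -/
inductive State (f : ℤ[X]) : Type
  /-- In Pre-Processing, inside FindSuitablePrime; `c` is the counter of FindSuitablePrime. -/
  | suitable (d : PreData) {e : ℕ} (C : Matrix (Fin e) (Fin (f.natDegree + 1)) ℤ) (c : ℕ)
  /-- In Pre-Processing, about to call LLL-with-removals on `A`. -/
  | preReduce (d : PreData) {k m : ℕ} (A : Matrix (Fin k) (Fin (f.natDegree + 1) ⊕ Fin m) ℤ)
  /-- Pre-Processing has returned the lattice `C`; a prime with `deg F_1 > 0` is sought. -/
  | select (d : PreData) {e : ℕ} (C : Matrix (Fin e) (Fin (f.natDegree + 1)) ℤ)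
  /-- In the loop over the roots, at the top of its body, with current lattice `C`. -/
  | loop (D : LoopData f) {e : ℕ} (C : Matrix (Fin e) (Fin (f.natDegree + 1)) ℤ)
  /-- In the loop over the roots, about to call LLL-with-removals on `A`. -/
  | loopReduce (D : LoopData f) {k m : ℕ}
      (A : Matrix (Fin k) (Fin (f.natDegree + 1) ⊕ Fin m) ℤ)
  /-- The algorithm has stopped with the list of isomorphisms found. -/
  | halt (out : List (NF f))

/-- The algorithm has stopped. -/
def State.Halted {f : ℤ[X]} (s : State f) : Prop := ∃ out, s = .halt out

/-- The initial configuration: `C` is the identity matrix, `p = 3`. -/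
def start (f : ℤ[X]) : State f :=
  .suitable ⟨3, 0, []⟩ (1 : Matrix (Fin (f.natDegree + 1)) (Fin (f.natDegree + 1)) ℤ) 0

/-- `q` is the smallest prime exceeding `p`. -/
def NextPrime (p : ℕ) (q : Nat.Primes) : Prop := IsLeast {r : ℕ | r.Prime ∧ p < r} (q : ℕ)

open Classical in
/-- Store `q` if `deg F_1 > 0`. -/
def store (f : ℤ[X]) (q : Nat.Primes) (l : List Nat.Primes) : List Nat.Primes :=
  if 0 < (ddFactor q f 1).natDegree then q :: l else l

/-- Preparation of the loop over the roots for the prime `q`: `D` lists the roots of `F_1`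
in some order, and some root of `G_1`. -/
def Prepared (f g : ℤ[X]) (b : ℝ) (q : Nat.Primes) {e : ℕ}
    (C : Matrix (Fin e) (Fin (f.natDegree + 1)) ℤ) (D : LoopData f) : Prop :=
  ∃ (xs : List ℚ_[(q : ℕ)]) (y : ℚ_[(q : ℕ)]),
    (xs : Multiset ℚ_[(q : ℕ)]) = (ddFactor q f 1).roots ∧ y ∈ (ddFactor q g 1).roots ∧
    D = ⟨q, xs, y, precision b e, e, C, []⟩

variable (f g : ℤ[X]) [Fact (Irreducible (toQ f))] (b : ℝ)

/-- One step of the algorithm FindIsomorphism, with bound `b`. -/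
inductive Step : State f → State f → Prop
  /- Pre-Processing, FindSuitablePrime: the next prime is bad. -/
  | suitable_bad (d : PreData) {e : ℕ} (C : Matrix (Fin e) (Fin (f.natDegree + 1)) ℤ) (c : ℕ)
      (q : Nat.Primes) (hq : NextPrime d.p q) (bad : ¬ IsGood f g q) :
      Step (.suitable d C c) (.suitable { d with p := q } C c)
  /- Only one degree occurs (`m = 1`); at most 25 times in this call: try the next prime. -/
  | suitable_one (d : PreData) {e : ℕ} (C : Matrix (Fin e) (Fin (f.natDegree + 1)) ℤ) (c : ℕ)
      (q : Nat.Primes) (hq : NextPrime d.p q) (good : IsGood f g q)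
      (one : (ddDegrees q f).ncard = 1) (few : c + 1 ≤ 25) :
      Step (.suitable d C c) (.suitable { d with p := q } C (c + 1))
  /- More than 25 times: the fields appear to be Galois, Pre-Processing returns `C`. -/
  | suitable_galois (d : PreData) {e : ℕ} (C : Matrix (Fin e) (Fin (f.natDegree + 1)) ℤ) (c : ℕ)
      (q : Nat.Primes) (hq : NextPrime d.p q) (good : IsGood f g q)
      (one : (ddDegrees q f).ncard = 1) (many : 25 < c + 1) :
      Step (.suitable d C c) (.select { d with p := q } C)
  /- The factorization patterns differ: there is no isomorphism. -/
  | suitable_differ (d : PreData) {e : ℕ} (C : Matrix (Fin e) (Fin (f.natDegree + 1)) ℤ) (c : ℕ)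
      (q : Nat.Primes) (hq : NextPrime d.p q) (good : IsGood f g q)
      (notone : (ddDegrees q f).ncard ≠ 1) (differ : ¬ SameShape f g q) :
      Step (.suitable d C c) (.halt [])
  /- A suitable prime, but `C T ≡ 0`, fewer than 10 times so far. -/
  | suitable_zero (d : PreData) {e : ℕ} (C : Matrix (Fin e) (Fin (f.natDegree + 1)) ℤ) (c : ℕ)
      (q : Nat.Primes) (hq : NextPrime d.p q) (good : IsGood f g q)
      (notone : (ddDegrees q f).ncard ≠ 1) (same : SameShape f g q)
      {m : ℕ} (T : Matrix (Fin (f.natDegree + 1)) (Fin m) ℤ)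
      (hT : IsTraceMatrix f g q (precision b e) T)
      (zero : Vanishes C T ((q : ℕ) ^ precision b e)) (few : d.cnt + 1 < 10) :
      Step (.suitable d C c) (.suitable ⟨q, d.cnt + 1, store f q d.stored⟩ C 0)
  /- `C T ≡ 0` for the tenth time: Pre-Processing returns `C`. -/
  | suitable_return (d : PreData) {e : ℕ} (C : Matrix (Fin e) (Fin (f.natDegree + 1)) ℤ) (c : ℕ)
      (q : Nat.Primes) (hq : NextPrime d.p q) (good : IsGood f g q)
      (notone : (ddDegrees q f).ncard ≠ 1) (same : SameShape f g q)
      {m : ℕ} (T : Matrix (Fin (f.natDegree + 1)) (Fin m) ℤ)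
      (hT : IsTraceMatrix f g q (precision b e) T)
      (zero : Vanishes C T ((q : ℕ) ^ precision b e)) (many : 10 ≤ d.cnt + 1) :
      Step (.suitable d C c) (.select ⟨q, d.cnt + 1, store f q d.stored⟩ C)
  /- Otherwise the augmented lattice will be reduced. -/
  | suitable_reduce (d : PreData) {e : ℕ} (C : Matrix (Fin e) (Fin (f.natDegree + 1)) ℤ) (c : ℕ)
      (q : Nat.Primes) (hq : NextPrime d.p q) (good : IsGood f g q)
      (notone : (ddDegrees q f).ncard ≠ 1) (same : SameShape f g q)
      {m : ℕ} (T : Matrix (Fin (f.natDegree + 1)) (Fin m) ℤ)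
      (hT : IsTraceMatrix f g q (precision b e) T)
      (nonzero : ¬ Vanishes C T ((q : ℕ) ^ precision b e)) :
      Step (.suitable d C c) (.preReduce ⟨q, d.cnt, store f q d.stored⟩
        (augment C T ((q : ℕ) ^ precision b e)))
  /- LLL-with-removals gives `[C, B]` with `B ≠ 0`: scale `B` and repeat. -/
  | pre_scale (d : PreData) {k m l : ℕ} (A : Matrix (Fin k) (Fin (f.natDegree + 1) ⊕ Fin m) ℤ)
      (L : Matrix (Fin l) (Fin (f.natDegree + 1) ⊕ Fin m) ℤ) (hL : LLLWithRemovals b A L)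
      (hB : L.toCols₂ ≠ 0) :
      Step (.preReduce d A) (.preReduce d (scale L))
  /- `B = 0` and `C` has at most one row: output. -/
  | pre_halt (d : PreData) {k m l : ℕ} (A : Matrix (Fin k) (Fin (f.natDegree + 1) ⊕ Fin m) ℤ)
      (L : Matrix (Fin l) (Fin (f.natDegree + 1) ⊕ Fin m) ℤ) (hL : LLLWithRemovals b A L)
      (hB : L.toCols₂ = 0) (hl : l ≤ 1) :
      Step (.preReduce d A) (.halt (outcome f g l L.toCols₁))
  /- `B = 0` and `C` has several rows: next prime. -/
  | pre_next (d : PreData) {k m l : ℕ} (A : Matrix (Fin k) (Fin (f.natDegree + 1) ⊕ Fin m) ℤ)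
      (L : Matrix (Fin l) (Fin (f.natDegree + 1) ⊕ Fin m) ℤ) (hL : LLLWithRemovals b A L)
      (hB : L.toCols₂ = 0) (hl : 1 < l) :
      Step (.preReduce d A) (.suitable d L.toCols₁ 0)
  /- FindIsomorphism: a stored prime with smallest `deg F_1` is chosen. -/
  | select_stored (d : PreData) {e : ℕ} (C : Matrix (Fin e) (Fin (f.natDegree + 1)) ℤ)
      (q : Nat.Primes) (hq : q ∈ d.stored)
      (least : ∀ r ∈ d.stored, (ddFactor q f 1).natDegree ≤ (ddFactor r f 1).natDegree)
      (D : LoopData f) (hD : Prepared f g b q C D) :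
      Step (.select d C) (.loop D C)
  /- No prime is stored; the next prime is bad. -/
  | select_bad (d : PreData) {e : ℕ} (C : Matrix (Fin e) (Fin (f.natDegree + 1)) ℤ)
      (none : d.stored = []) (q : Nat.Primes) (hq : NextPrime d.p q) (bad : ¬ IsGood f g q) :
      Step (.select d C) (.select { d with p := q } C)
  /- No prime is stored; at the next prime the factorization patterns differ. -/
  | select_differ (d : PreData) {e : ℕ} (C : Matrix (Fin e) (Fin (f.natDegree + 1)) ℤ)
      (none : d.stored = []) (q : Nat.Primes) (hq : NextPrime d.p q) (good : IsGood f g q)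
      (differ : ¬ SameShape f g q) :
      Step (.select d C) (.halt [])
  /- No prime is stored; the next prime has `deg F_1 = 0`. -/
  | select_noroot (d : PreData) {e : ℕ} (C : Matrix (Fin e) (Fin (f.natDegree + 1)) ℤ)
      (none : d.stored = []) (q : Nat.Primes) (hq : NextPrime d.p q) (good : IsGood f g q)
      (same : SameShape f g q) (noroot : (ddFactor q f 1).natDegree = 0) :
      Step (.select d C) (.select { d with p := q } C)
  /- No prime is stored; the next prime has `deg F_1 > 0` and is chosen. -/
  | select_found (d : PreData) {e : ℕ} (C : Matrix (Fin e) (Fin (f.natDegree + 1)) ℤ)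
      (none : d.stored = []) (q : Nat.Primes) (hq : NextPrime d.p q) (good : IsGood f g q)
      (same : SameShape f g q) (root : 0 < (ddFactor q f 1).natDegree)
      (D : LoopData f) (hD : Prepared f g b q C D) :
      Step (.select d C) (.loop D C)
  /- All roots have been treated. -/
  | loop_halt (D : LoopData f) {e : ℕ} (C : Matrix (Fin e) (Fin (f.natDegree + 1)) ℤ)
      (done : D.roots = []) :
      Step (.loop D C) (.halt D.out)
  /- `C T ≡ 0`, so `C` stays as it is, and it has several rows: double the precision. -/
  | loop_zero (D : LoopData f) {e : ℕ} (C : Matrix (Fin e) (Fin (f.natDegree + 1)) ℤ)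
      (x : ℚ_[(D.p : ℕ)]) (xs : List ℚ_[(D.p : ℕ)]) (hx : D.roots = x :: xs)
      (T : Matrix (Fin (f.natDegree + 1)) (Fin 1) ℤ) (hT : IsRootMatrix f D.p D.a x D.y T)
      (zero : Vanishes C T ((D.p : ℕ) ^ D.a)) (he : 1 < e) :
      Step (.loop D C) (.loop { D with a := 2 * D.a } C)
  /- `C T ≡ 0`, and `C` has at most one row: output for this root, next root. -/
  | loop_zero_next (D : LoopData f) {e : ℕ} (C : Matrix (Fin e) (Fin (f.natDegree + 1)) ℤ)
      (x : ℚ_[(D.p : ℕ)]) (xs : List ℚ_[(D.p : ℕ)]) (hx : D.roots = x :: xs)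
      (T : Matrix (Fin (f.natDegree + 1)) (Fin 1) ℤ) (hT : IsRootMatrix f D.p D.a x D.y T)
      (zero : Vanishes C T ((D.p : ℕ) ^ D.a)) (he : e ≤ 1) :
      Step (.loop D C) (.loop { D with roots := xs, out := D.out ++ outcome f g e C } D.C₀)
  /- Otherwise the augmented lattice will be reduced. -/
  | loop_reduce (D : LoopData f) {e : ℕ} (C : Matrix (Fin e) (Fin (f.natDegree + 1)) ℤ)
      (x : ℚ_[(D.p : ℕ)]) (xs : List ℚ_[(D.p : ℕ)]) (hx : D.roots = x :: xs)
      (T : Matrix (Fin (f.natDegree + 1)) (Fin 1) ℤ) (hT : IsRootMatrix f D.p D.a x D.y T)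
      (nonzero : ¬ Vanishes C T ((D.p : ℕ) ^ D.a)) :
      Step (.loop D C) (.loopReduce D (augment C T ((D.p : ℕ) ^ D.a)))
  /- LLL-with-removals gives `[C, B]` with `B ≠ 0`: scale `B` and repeat. -/
  | loop_scale (D : LoopData f) {k m l : ℕ}
      (A : Matrix (Fin k) (Fin (f.natDegree + 1) ⊕ Fin m) ℤ)
      (L : Matrix (Fin l) (Fin (f.natDegree + 1) ⊕ Fin m) ℤ) (hL : LLLWithRemovals b A L)
      (hB : L.toCols₂ ≠ 0) :
      Step (.loopReduce D A) (.loopReduce D (scale L))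
  /- `B = 0` and `C` has at most one row: output for this root, next root. -/
  | loop_next (D : LoopData f) {k m l : ℕ}
      (A : Matrix (Fin k) (Fin (f.natDegree + 1) ⊕ Fin m) ℤ)
      (L : Matrix (Fin l) (Fin (f.natDegree + 1) ⊕ Fin m) ℤ) (hL : LLLWithRemovals b A L)
      (hB : L.toCols₂ = 0) (hl : l ≤ 1) :
      Step (.loopReduce D A)
        (.loop { D with roots := D.roots.tail, out := D.out ++ outcome f g l L.toCols₁ } D.C₀)
  /- `B = 0` and `C` has several rows: double the precision, same root. -/
  | loop_double (D : LoopData f) {k m l : ℕ}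
      (A : Matrix (Fin k) (Fin (f.natDegree + 1) ⊕ Fin m) ℤ)
      (L : Matrix (Fin l) (Fin (f.natDegree + 1) ⊕ Fin m) ℤ) (hL : LLLWithRemovals b A L)
      (hB : L.toCols₂ = 0) (hl : 1 < l) :
      Step (.loopReduce D A) (.loop { D with a := 2 * D.a } L.toCols₁)

/-- A (possibly nondeterministic) machine terminates from `s₀`: it never gets stuck before
having halted, and it has no infinite run. -/
structure Terminates {σ : Type} (step : σ → σ → Prop) (halted : σ → Prop) (s₀ : σ) : Prop where
  progress : ∀ s, Relation.ReflTransGen step s₀ s → ¬ halted s → ∃ t, step s t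
  finite : ¬ ∃ run : ℕ → σ, run 0 = s₀ ∧ ∀ k, step (run k) (run (k + 1))

end

end FindIso

/-! No correctness of the output is at stake: only that no configuration blocks the run and that
every loop ends. Both are packaged in `Halting`, an accessibility predicate that also carries
progress.

Progress. Every integer lattice has an LLL-reduced basis, and a prefix of a reduced basis is
reduced, so removals can be performed until the last Gram-Schmidt length is at most b
(`exists_lllWithRemovals`). Residues exist at a good prime p because p divides neither leading
coefficients nor discriminants: roots are integral over ℤ_p and f'(α) is a unit, so all values are
integral, and sub-traces lie in ℚ_p by Galois invariance. Matching patterns turn a linear factor of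
f into a root of G_1.

Finiteness rests on one estimate: in an LLL-reduced basis Gram-Schmidt lengths at most double going
backwards, so when the last one is at most b all entries are bounded by a constant depending only on
b and the rank (`entryBound`). It is used twice. Inside one reduction, after t scalings the second
block is divisible by 10^(20t) yet bounded, so B = 0 eventually (`reduction_induction`). Across
reductions, the result lies in the sublattice of c with cT ≡ 0 mod p^a, which is proper because the
reduction only starts when CT is not ≡ 0. Strict descent alone is not enough, since the index may
grow forever; but all results belong to the finite set of lattices having a basis with bounded
entries, so only finitely many reductions occur (`boundedLattices_induction`).

What remains are the phases without reduction. In Pre-Processing the two counters and the finiteness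
of the set of bad primes bound the wait. In the search for a prime, f has roots modulo infinitely
many primes, and Hensel lifts such a root at a good prime (`exists_isGood_prime_with_root`). In the
loop over the roots, the exact integer relations among the Base_i(α_j) and β_1 have rank at most
one, so a lattice of rank at least two has a row that is not a relation modulo p^a once a is large;
doubling a therefore leads to a further reduction (`exists_not_vanishes`). -/

namespace FindIso

noncomputable section

/-! ### Gram-Schmidt vectors -/

section GramSchmidt

variable {E : Type} [NormedAddCommGroup E] [InnerProductSpace ℝ E] {k : ℕ}

open InnerProductSpace

theorem sub_gramSchmidt_mem_span (v : Fin k → E) (j : Fin k) :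
    v j - gramSchmidt ℝ v j ∈ Submodule.span ℝ (v '' Set.Iio j) := by
  rw [← span_gramSchmidt_Iio ℝ v j, gramSchmidt_def ℝ v j, sub_sub_cancel]
  refine Submodule.sum_mem _ fun i hi => ?_
  rw [Submodule.starProjection_singleton]
  exact Submodule.smul_mem _ _ (Submodule.subset_span ⟨i, by simpa using hi, rfl⟩)

theorem gramSchmidt_inner_eq_zero_of_mem_span (v : Fin k → E) (j : Fin k) {w : E}
    (hw : w ∈ Submodule.span ℝ (v '' Set.Iio j)) : inner ℝ (gramSchmidt ℝ v j) w = 0 := by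
  induction hw using Submodule.span_induction with
  | mem x hx =>
    obtain ⟨i, hi, rfl⟩ := hx
    exact gramSchmidt_inv_triangular ℝ v hi
  | zero => simp
  | add x y _ _ hx hy => rw [inner_add_right, hx, hy, add_zero]
  | smul a x _ hx => rw [inner_smul_right, hx, mul_zero]

/-- The Gram-Schmidt vector is the only vector that is congruent to `v j` modulo the span of the
preceding vectors and orthogonal to that span. -/
theorem eq_gramSchmidt (v : Fin k → E) (j : Fin k) {w : E}
    (hw : v j - w ∈ Submodule.span ℝ (v '' Set.Iio j))
    (horth : ∀ u ∈ Submodule.span ℝ (v '' Set.Iio j), inner ℝ w u = 0) :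
    w = gramSchmidt ℝ v j := by
  have h : w - gramSchmidt ℝ v j ∈ Submodule.span ℝ (v '' Set.Iio j) := by
    have := Submodule.sub_mem _ (sub_gramSchmidt_mem_span v j) hw
    simpa using this
  rw [← sub_eq_zero, ← inner_self_eq_zero (𝕜 := ℝ)]
  conv_lhs => rw [inner_sub_left]
  rw [horth _ h, gramSchmidt_inner_eq_zero_of_mem_span v j h, sub_zero]

/-- Pythagoras: the Gram-Schmidt vector is the shortest element of its coset modulo the span of the
preceding vectors. -/
theorem norm_gramSchmidt_le (v : Fin k → E) (j : Fin k) {w : E}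
    (hw : v j - w ∈ Submodule.span ℝ (v '' Set.Iio j)) : ‖gramSchmidt ℝ v j‖ ≤ ‖w‖ := by
  have h : w - gramSchmidt ℝ v j ∈ Submodule.span ℝ (v '' Set.Iio j) := by
    have := Submodule.sub_mem _ (sub_gramSchmidt_mem_span v j) hw
    simpa using this
  have h2 := norm_add_sq_real (gramSchmidt ℝ v j) (w - gramSchmidt ℝ v j)
  rw [gramSchmidt_inner_eq_zero_of_mem_span v j h, add_sub_cancel] at h2
  refine le_of_sq_le_sq ?_ (norm_nonneg _)
  nlinarith [sq_nonneg ‖w - gramSchmidt ℝ v j‖]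

theorem gramSchmidt_congr (v w : Fin k → E) (j : Fin k) (hj : v j = w j)
    (himg : v '' Set.Iio j = w '' Set.Iio j) : gramSchmidt ℝ v j = gramSchmidt ℝ w j := by
  apply eq_gramSchmidt
  · rw [← himg, ← hj]
    exact sub_gramSchmidt_mem_span v j
  · intro u hu
    rw [← himg] at hu
    exact gramSchmidt_inner_eq_zero_of_mem_span v j hu

/-- Adding combinations of preceding vectors does not change the Gram-Schmidt vectors. -/
theorem gramSchmidt_eq_of_sub_mem_span (v w : Fin k → E)
    (h : ∀ j, w j - v j ∈ Submodule.span ℝ (v '' Set.Iio j)) (j : Fin k) :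
    gramSchmidt ℝ w j = gramSchmidt ℝ v j := by
  induction j using WellFoundedLT.induction with
  | ind j ih =>
    have hspan : Submodule.span ℝ (v '' Set.Iio j) = Submodule.span ℝ (w '' Set.Iio j) := by
      rw [← span_gramSchmidt_Iio ℝ v j, ← span_gramSchmidt_Iio ℝ w j]
      congr 1
      exact (Set.image_congr fun i hi => ih i hi).symm
    refine (eq_gramSchmidt w j ?_ ?_).symm
    · rw [← hspan]
      have := Submodule.add_mem _ (h j) (sub_gramSchmidt_mem_span v j)
      simpa using this
    · rw [← hspan]
      exact fun u hu => gramSchmidt_inner_eq_zero_of_mem_span v j hu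

theorem gramSchmidt_castSucc (v : Fin (k + 1) → E) (j : Fin k) :
    gramSchmidt ℝ (fun i : Fin k => v i.castSucc) j = gramSchmidt ℝ v j.castSucc := by
  have himg : (fun i : Fin k => v i.castSucc) '' Set.Iio j = v '' Set.Iio j.castSucc := by
    ext x
    constructor
    · rintro ⟨i, hi, rfl⟩
      exact ⟨i.castSucc, by simpa using hi, rfl⟩
    · rintro ⟨i, hi, rfl⟩
      have hik : (i : ℕ) < k := lt_trans (Fin.lt_def.1 hi) j.2
      exact ⟨⟨i, hik⟩, Fin.lt_def.2 (Fin.lt_def.1 hi), rfl⟩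
  refine (eq_gramSchmidt (fun i : Fin k => v i.castSucc) j ?_ ?_).symm
  · rw [himg]
    exact sub_gramSchmidt_mem_span v j.castSucc
  · rw [himg]
    exact fun u hu => gramSchmidt_inner_eq_zero_of_mem_span v j.castSucc hu

end GramSchmidt

/-! ### Bounds on the entries of reduced bases -/

section Bounds

variable {ι : Type} [Fintype ι] {k : ℕ}

theorem rowVec_eq_gs_add (L : Matrix (Fin k) ι ℤ) (i : Fin k) :
    rowVec L i = gs L i + ∑ j ∈ Finset.Iio i, mu L i j • gs L j :=
  InnerProductSpace.gramSchmidt_def'' ℝ (rowVec L) i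

theorem abs_apply_le_norm_rowVec (L : Matrix (Fin k) ι ℤ) (i : Fin k) (j : ι) :
    |(L i j : ℝ)| ≤ ‖rowVec L i‖ := by
  simpa [rowVec] using PiLp.norm_apply_le (rowVec L i) j

/-- The rows of a size-reduced matrix are bounded in terms of the Gram-Schmidt lengths. -/
theorem norm_rowVec_le (L : Matrix (Fin k) ι ℤ) (hsize : ∀ i j, j < i → |mu L i j| ≤ 1 / 2)
    {M : ℝ} (hM : ∀ i, ‖gs L i‖ ≤ M) (i : Fin k) : ‖rowVec L i‖ ≤ (k + 1) * M := by
  have hM0 : 0 ≤ M := (norm_nonneg _).trans (hM i)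
  rw [rowVec_eq_gs_add]
  have h1 : ‖∑ j ∈ Finset.Iio i, mu L i j • gs L j‖ ≤ k * M := by
    refine (norm_sum_le_of_le _ (f := fun j => mu L i j • gs L j) (n := fun _ => M) ?_).trans ?_
    · intro j hj
      rw [norm_smul, Real.norm_eq_abs]
      have := hsize i j (Finset.mem_Iio.1 hj)
      calc |mu L i j| * ‖gs L j‖ ≤ 1 * M := by
            gcongr
            · linarith
            · exact hM j
        _ = M := one_mul M
    · rw [Finset.sum_const, nsmul_eq_mul]
      gcongr
      simp [i.2.le]
  calc _ ≤ ‖gs L i‖ + ‖∑ j ∈ Finset.Iio i, mu L i j • gs L j‖ := norm_add_le _ _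
    _ ≤ M + k * M := add_le_add (hM i) h1
    _ = _ := by ring

/-- Integer matrices with bounded rows form a finite set. -/
theorem finite_bounded_matrices (κ : Type) [Finite κ] (R : ℝ) :
    {L : Matrix κ ι ℤ | ∀ i j, |(L i j : ℝ)| ≤ R}.Finite := by
  have h : (Set.pi Set.univ fun _ : κ => Set.pi Set.univ fun _ : ι => Set.Icc (-⌊R⌋) ⌊R⌋).Finite :=
    Set.Finite.pi fun _ => Set.Finite.pi fun _ => Set.finite_Icc _ _
  refine h.subset fun L hL i _ j _ => ?_
  have h1 := abs_le.1 (hL i j)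
  rw [Set.mem_Icc, neg_le, Int.le_floor, Int.le_floor]
  push_cast
  exact ⟨by linarith, h1.2⟩

/-- The bound on the entries of a reduced basis whose last Gram-Schmidt length is at most `b`. -/
def entryBound (b : ℝ) (k : ℕ) : ℝ := (k + 1) * (2 ^ k * b)

namespace IsLLLReduced

/-- Lovász together with |μ| ≤ 1/2 and orthogonality gives ‖b_j*‖² ≤ 2‖b_i*‖². The cruder factor 2
for the lengths keeps the later bounds free of square roots. -/
theorem norm_gs_le_two_mul {L : Matrix (Fin k) ι ℤ} (hL : IsLLLReduced L) (i j : Fin k)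
    (hij : (j : ℕ) + 1 = i) : ‖gs L j‖ ≤ 2 * ‖gs L i‖ := by
  have hji : j < i := Fin.lt_def.2 (by omega)
  have h1 := hL.lovasz i j hij
  have horth : inner ℝ (gs L i) (mu L i j • gs L j) = 0 := by
    rw [inner_smul_right]
    have : inner ℝ (gs L i) (gs L j) = 0 :=
      InnerProductSpace.gramSchmidt_orthogonal ℝ (rowVec L) hji.ne'
    rw [this, mul_zero]
  have h2 := norm_add_sq_real (gs L i) (mu L i j • gs L j)
  rw [horth, norm_smul, Real.norm_eq_abs] at h2
  have h3 : |mu L i j| ^ 2 ≤ 1 / 4 := by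
    have := hL.size i j hji
    have h0 := abs_nonneg (mu L i j)
    nlinarith
  rw [h2, mul_pow] at h1
  refine le_of_sq_le_sq ?_ (by positivity)
  nlinarith [mul_le_mul_of_nonneg_right h3 (sq_nonneg ‖gs L j‖)]

theorem norm_gs_le {L : Matrix (Fin k) ι ℤ} (hL : IsLLLReduced L) {b : ℝ}
    (hb : ∀ i : Fin k, (i : ℕ) + 1 = k → ‖gs L i‖ ≤ b) (i : Fin k) : ‖gs L i‖ ≤ 2 ^ k * b := by
  have hk : 0 < k := i.pos
  -- The index i witnesses k > 0, so there is a last vector, and its length makes b nonnegative.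
  have hb0 : 0 ≤ b := (norm_nonneg _).trans (hb ⟨k - 1, by omega⟩ (by simp; omega))
  have key : ∀ t : ℕ, ∀ i : Fin k, (i : ℕ) + 1 + t = k → ‖gs L i‖ ≤ 2 ^ t * b := by
    intro t
    induction t with
    | zero => intro i hi; simpa using hb i (by omega)
    | succ t ih =>
      intro i hi
      have h1 := ih ⟨i + 1, by omega⟩ (by simp; omega)
      have h2 := hL.norm_gs_le_two_mul ⟨i + 1, by omega⟩ i rfl
      rw [pow_succ]
      linarith
  refine (key (k - (i + 1)) i (by omega)).trans ?_
  gcongr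
  · norm_num
  · omega

theorem abs_apply_le {L : Matrix (Fin k) ι ℤ} (hL : IsLLLReduced L) {b : ℝ}
    (hb : ∀ i : Fin k, (i : ℕ) + 1 = k → ‖gs L i‖ ≤ b) (i : Fin k) (j : ι) :
    |(L i j : ℝ)| ≤ entryBound b k :=
  (abs_apply_le_norm_rowVec L i j).trans (norm_rowVec_le L hL.size (hL.norm_gs_le hb) i)

theorem card_le {L : Matrix (Fin k) ι ℤ} (hL : IsLLLReduced L) : k ≤ Fintype.card ι := by
  simpa using hL.indep.fintype_card_le_finrank

end IsLLLReduced

end Bounds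

/-! ### Existence of reduced bases -/

section Lattice

variable {ι : Type} {k : ℕ}

/-- The change of rows is unitriangular over ℤ, hence invertible over ℤ. -/
theorem rowLattice_eq_of_sub_mem (L L' : Matrix (Fin k) ι ℤ)
    (h : ∀ i, L' i - L i ∈ Submodule.span ℤ (L '' Set.Iio i)) : rowLattice L' = rowLattice L := by
  apply le_antisymm
  · refine Submodule.span_le.2 ?_
    rintro _ ⟨i, rfl⟩
    have h1 := Submodule.span_mono (Set.image_subset_range _ _) (h i)
    have := Submodule.add_mem _ h1 (Submodule.subset_span (s := Set.range L) ⟨i, rfl⟩)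
    rwa [sub_add_cancel] at this
  · refine Submodule.span_le.2 ?_
    rintro _ ⟨i, rfl⟩
    induction i using WellFoundedLT.induction with
    | ind i ih =>
      have h1 : Submodule.span ℤ (L '' Set.Iio i) ≤ rowLattice L' := by
        refine Submodule.span_le.2 ?_
        rintro _ ⟨j, hj, rfl⟩
        exact ih j hj
      have := Submodule.sub_mem _ (Submodule.subset_span (s := Set.range L') ⟨i, rfl⟩) (h1 (h i))
      rwa [sub_sub_cancel] at this

theorem rowLattice_comp_equiv (L : Matrix (Fin k) ι ℤ) (σ : Equiv.Perm (Fin k)) :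
    rowLattice (L ∘ σ : Matrix (Fin k) ι ℤ) = rowLattice L := by
  have : Set.range (L ∘ σ) = Set.range L := σ.surjective.range_comp L
  exact congrArg (Submodule.span ℤ) this

end Lattice

section Existence

variable {ι : Type} [Fintype ι] {k : ℕ}

theorem gs_eq_of_sub_mem (L L' : Matrix (Fin k) ι ℤ)
    (h : ∀ i, L' i - L i ∈ Submodule.span ℤ (L '' Set.Iio i)) : gs L' = gs L := by
  funext i
  refine gramSchmidt_eq_of_sub_mem_span _ _ (fun j => ?_) i
  let φ : (ι → ℤ) →+ EuclideanSpace ℝ ι :=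
    { toFun := fun v => WithLp.toLp 2 fun j => (v j : ℝ)
      map_zero' := by ext; simp
      map_add' := by intro x y; ext; simp }
  have hφ : ∀ x ∈ Submodule.span ℤ (L '' Set.Iio j),
      φ x ∈ Submodule.span ℝ (rowVec L '' Set.Iio j) := by
    intro x hx
    induction hx using Submodule.span_induction with
    | mem x hx =>
      obtain ⟨i, hi, rfl⟩ := hx
      exact Submodule.subset_span ⟨i, hi, rfl⟩
    | zero => rw [map_zero]; exact Submodule.zero_mem _
    | add x y _ _ hx hy => rw [map_add]; exact Submodule.add_mem _ hx hy
    | smul a x _ hx => rw [map_zsmul]; exact zsmul_mem hx a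
  have := hφ _ (h j)
  rwa [map_sub] at this

/-- One row can be size-reduced by subtracting a combination of the preceding rows. -/
theorem exists_size_reduced_row (L : Matrix (Fin k) ι ℤ) (i : Fin k) :
    ∃ x ∈ Submodule.span ℤ (L '' Set.Iio i), ∀ j < i,
      |inner ℝ (gs L j) (WithLp.toLp 2 fun s => ((L i + x) s : ℝ)) / ‖gs L j‖ ^ 2| ≤ 1 / 2 := by
  -- The coefficients are reduced from j = i - 1 downwards; after t steps those with j ≥ i - t are
  -- small. Subtracting a multiple of b_j₀ leaves the coefficients at j > j₀ alone, because b_j₀ is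
  -- orthogonal to b_j*.
  have key : ∀ t : ℕ, t ≤ i → ∃ x ∈ Submodule.span ℤ (L '' Set.Iio i), ∀ j < i, (i : ℕ) ≤ j + t →
      |inner ℝ (gs L j) (WithLp.toLp 2 fun s => ((L i + x) s : ℝ)) / ‖gs L j‖ ^ 2| ≤ 1 / 2 := by
    intro t
    induction t with
    | zero =>
      exact fun _ => ⟨0, Submodule.zero_mem _, fun j hj hij => absurd (Fin.lt_def.1 hj) (by omega)⟩
    | succ t ih =>
      intro ht
      obtain ⟨x, hx, hxj⟩ := ih (by omega)
      let j₀ : Fin k := ⟨i - (t + 1), by omega⟩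
      have hj₀ : j₀ < i := Fin.lt_def.2 (by simp [j₀]; omega)
      set r : ℝ := inner ℝ (gs L j₀) (WithLp.toLp 2 fun s => ((L i + x) s : ℝ)) / ‖gs L j₀‖ ^ 2
        with hr
      have hvec : (WithLp.toLp 2 fun s => ((L i + (x - round r • L j₀)) s : ℝ) :
          EuclideanSpace ℝ ι) =
          (WithLp.toLp 2 fun s => ((L i + x) s : ℝ)) - (round r : ℝ) • rowVec L j₀ := by
        ext s
        simp [rowVec]
        ring
      refine ⟨x - round r • L j₀, Submodule.sub_mem _ hx
        (Submodule.smul_mem _ _ (Submodule.subset_span ⟨j₀, hj₀, rfl⟩)), fun j hj hij => ?_⟩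
      rw [hvec, inner_sub_right, inner_smul_right]
      rcases eq_or_ne j j₀ with rfl | hne
      · rcases eq_or_ne (gs L j₀) 0 with h0 | h0
        -- A zero Gram-Schmidt vector gives coefficient 0 / 0 = 0, so independence of the rows is
        -- not needed.
        · simp [h0]
        · have hself : inner ℝ (gs L j₀) (rowVec L j₀) = ‖gs L j₀‖ ^ 2 := by
            have h1 := gramSchmidt_inner_eq_zero_of_mem_span _ _
              (sub_gramSchmidt_mem_span (rowVec L) j₀)
            rw [inner_sub_right, real_inner_self_eq_norm_sq, sub_eq_zero] at h1
            exact h1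
          have hn : ‖gs L j₀‖ ^ 2 ≠ 0 := by simpa using h0
          rw [hself, sub_div, ← hr, mul_div_cancel_right₀ _ hn]
          exact abs_sub_round r
      · have hlt : j₀ < j := by
          refine lt_of_le_of_ne (Fin.le_def.2 ?_) hne.symm
          simp [j₀]
          omega
        have h0 : inner ℝ (gs L j) (rowVec L j₀) = 0 :=
          InnerProductSpace.gramSchmidt_inv_triangular ℝ (rowVec L) hlt
        have hlt' : (i : ℕ) - (t + 1) < j := Fin.lt_def.1 hlt
        rw [h0, mul_zero, sub_zero]
        exact hxj j hj (by omega)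
  obtain ⟨x, hx, hxj⟩ := key i le_rfl
  exact ⟨x, hx, fun j hj => hxj j hj (by omega)⟩

/-- Size reduction changes neither the lattice nor the Gram-Schmidt vectors. -/
theorem exists_size_reduced (L : Matrix (Fin k) ι ℤ) :
    ∃ L' : Matrix (Fin k) ι ℤ, rowLattice L' = rowLattice L ∧ gs L' = gs L ∧
      ∀ i j, j < i → |mu L' i j| ≤ 1 / 2 := by
  choose x hx hxj using exists_size_reduced_row L
  have hL' : ∀ i, (fun i => L i + x i : Matrix (Fin k) ι ℤ) i - L i ∈
      Submodule.span ℤ (L '' Set.Iio i) := fun i => by simpa using hx i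
  refine ⟨fun i => L i + x i, rowLattice_eq_of_sub_mem L _ hL', gs_eq_of_sub_mem L _ hL',
    fun i j hji => ?_⟩
  simp only [mu, gs_eq_of_sub_mem L _ hL']
  exact hxj i j hji

/-- The Gram-Schmidt vectors after two adjacent rows have been exchanged. -/
theorem gs_swap {L : Matrix (Fin k) ι ℤ} {i j : Fin k} (hij : (j : ℕ) + 1 = i) :
    (∀ l < j, gs (L ∘ Equiv.swap i j) l = gs L l) ∧
    gs (L ∘ Equiv.swap i j) j = gs L i + mu L i j • gs L j ∧
    ‖gs (L ∘ Equiv.swap i j) i‖ ≤ ‖gs L j‖ ∧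
    (∀ l, i < l → gs (L ∘ Equiv.swap i j) l = gs L l) := by
  have hji : j < i := Fin.lt_def.2 (by omega)
  have hrow : ∀ l, rowVec (L ∘ Equiv.swap i j) l = rowVec L (Equiv.swap i j l) := fun _ => rfl
  have hfix : ∀ l < j, Equiv.swap i j l = l := fun l hl =>
    Equiv.swap_apply_of_ne_of_ne (hl.trans hji).ne hl.ne
  have hlow : ∀ l ≤ j, rowVec (L ∘ Equiv.swap i j) '' Set.Iio l = rowVec L '' Set.Iio l := by
    intro l hl
    refine Set.image_congr fun s hs => ?_
    rw [hrow, hfix s (lt_of_lt_of_le hs hl)]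
  refine ⟨fun l hl => ?_, ?_, ?_, fun l hl => ?_⟩
  · exact gramSchmidt_congr _ _ _ (by rw [hrow, hfix l hl]) (hlow l hl.le)
  · symm
    apply eq_gramSchmidt
    -- The part of b_i orthogonal to the rows before j is b_i* + μ b_j*: the expansion of b_i loses
    -- exactly its terms below j.
    · rw [hrow, Equiv.swap_apply_right, hlow j le_rfl, ← InnerProductSpace.span_gramSchmidt_Iio]
      have hIio : Finset.Iio i = insert j (Finset.Iio j) := by
        ext s
        simp only [Finset.mem_Iio, Finset.mem_insert, Fin.lt_def, Fin.ext_iff]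
        omega
      rw [rowVec_eq_gs_add, hIio, Finset.sum_insert (by simp)]
      have : gs L i + (mu L i j • gs L j + ∑ s ∈ Finset.Iio j, mu L i s • gs L s) -
          (gs L i + mu L i j • gs L j) = ∑ s ∈ Finset.Iio j, mu L i s • gs L s := by abel
      rw [this]
      exact Submodule.sum_mem _ fun s hs => Submodule.smul_mem _ _
        (Submodule.subset_span ⟨s, by simpa using hs, rfl⟩)
    · rw [hlow j le_rfl]
      intro u hu
      have hu' : u ∈ Submodule.span ℝ (rowVec L '' Set.Iio i) :=
        Submodule.span_mono (Set.image_mono (Set.Iio_subset_Iio hji.le)) hu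
      have h1 : inner ℝ (gs L i) u = 0 := gramSchmidt_inner_eq_zero_of_mem_span _ _ hu'
      have h2 : inner ℝ (gs L j) u = 0 := gramSchmidt_inner_eq_zero_of_mem_span _ _ hu
      rw [inner_add_left, inner_smul_left, h1, h2, mul_zero, add_zero]
  -- Row i is now the old b_j, which differs from b_j* by a combination of the rows before j; all of
  -- these still precede row i.
  · apply norm_gramSchmidt_le
    rw [hrow, Equiv.swap_apply_left]
    have h1 := sub_gramSchmidt_mem_span (rowVec L) j
    rw [← hlow j le_rfl] at h1
    exact Submodule.span_mono (Set.image_mono (Set.Iio_subset_Iio hji.le)) h1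
  · refine gramSchmidt_congr _ _ _ ?_ ?_
    · rw [hrow, Equiv.swap_apply_of_ne_of_ne hl.ne' (hji.trans hl).ne']
    · have hswap : ∀ s ∈ Set.Iio l, Equiv.swap i j s ∈ Set.Iio l := by
        intro s hs
        by_cases h1 : s = i
        · rw [h1, Equiv.swap_apply_left]; exact hji.trans hl
        by_cases h2 : s = j
        · rw [h2, Equiv.swap_apply_right]; exact hl
        rwa [Equiv.swap_apply_of_ne_of_ne h1 h2]
      ext v
      constructor
      · rintro ⟨s, hs, rfl⟩
        exact ⟨_, hswap s hs, rfl⟩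
      · rintro ⟨s, hs, rfl⟩
        exact ⟨_, hswap s hs, by rw [hrow, Equiv.swap_apply_self]⟩

/-- Every lattice with a basis of `k` rows has an LLL-reduced basis. -/
theorem exists_isLLLReduced_of_linearIndependent (L : Matrix (Fin k) ι ℤ)
    (hL : LinearIndependent ℤ L.row) :
    ∃ L' : Matrix (Fin k) ι ℤ, rowLattice L' = rowLattice L ∧ IsLLLReduced L' := by
  obtain ⟨M, hM⟩ : ∃ M : ℝ, ∀ i, ‖gs L i‖ ≤ M := by
    obtain ⟨M, hM⟩ := (Set.finite_range fun i => ‖gs L i‖).bddAbove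
    exact ⟨M, fun i => hM ⟨i, rfl⟩⟩
  -- Size-reduced systems with Gram-Schmidt lengths at most M have bounded integer entries, so they
  -- form a finite set. The one with lexicographically least sequence of lengths satisfies Lovász:
  -- otherwise a swap followed by size reduction stays in the set and lowers the sequence at j.
  let s : Set (Matrix (Fin k) ι ℤ) := {L' | rowLattice L' = rowLattice L ∧
    (∀ i j, j < i → |mu L' i j| ≤ 1 / 2) ∧ ∀ i, ‖gs L' i‖ ≤ M}
  have hs : s.Finite := (finite_bounded_matrices (Fin k) ((k + 1) * M)).subset
    fun L' hL' i j => (abs_apply_le_norm_rowVec L' i j).trans (norm_rowVec_le L' hL'.2.1 hL'.2.2 i)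
  have hne : s.Nonempty := by
    obtain ⟨L', h1, h2, h3⟩ := exists_size_reduced L
    exact ⟨L', h1, h3, by rwa [h2]⟩
  obtain ⟨L', hL', hmin⟩ := Set.exists_min_image s
    (fun L' => toLex fun i => ‖gs L' i‖) hs hne
  refine ⟨L', hL'.1, ?_, hL'.2.1, ?_⟩
  -- Independence of k generators only says that the lattice has rank k, so it passes to any other k
  -- generators.
  · rw [linearIndependent_iff_card_eq_finrank_span] at hL ⊢
    rw [hL]
    exact congrArg (fun Λ : Submodule ℤ (ι → ℤ) => Module.finrank ℤ Λ) hL'.1.symm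
  · intro i j hij
    by_contra! hlt
    obtain ⟨h1, h2, h3, h4⟩ := gs_swap (L := L') hij
    have hji : j < i := Fin.lt_def.2 (by omega)
    have hsmall : ‖gs (L' ∘ Equiv.swap i j) j‖ < ‖gs L' j‖ := by
      rw [h2]
      refine lt_of_pow_lt_pow_left₀ 2 (norm_nonneg _) ?_
      nlinarith [sq_nonneg ‖gs L' j‖]
    obtain ⟨L'', e1, e2, e3⟩ := exists_size_reduced (L' ∘ Equiv.swap i j : Matrix (Fin k) ι ℤ)
    have hmem : L'' ∈ s := by
      refine ⟨(e1.trans (rowLattice_comp_equiv L' _)).trans hL'.1, e3, fun l => ?_⟩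
      rw [e2]
      rcases lt_trichotomy l j with hl | rfl | hl
      · rw [h1 l hl]; exact hL'.2.2 l
      · exact hsmall.le.trans (hL'.2.2 l)
      · rcases eq_or_ne l i with rfl | hli
        · exact h3.trans (hL'.2.2 j)
        · have : i < l := by
            rw [Fin.lt_def] at hl ⊢
            have := Fin.val_ne_of_ne hli
            omega
          rw [h4 l this]; exact hL'.2.2 l
    refine not_lt_of_ge (hmin L'' hmem) ?_
    refine ⟨j, fun l hl => ?_, ?_⟩
    · show ‖gs L'' l‖ = ‖gs L' l‖
      rw [e2, h1 l hl]
    · show ‖gs L'' j‖ < ‖gs L' j‖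
      rw [e2]
      exact hsmall

theorem exists_isLLLReduced (Λ : Submodule ℤ (ι → ℤ)) :
    ∃ (k : ℕ) (L : Matrix (Fin k) ι ℤ), rowLattice L = Λ ∧ IsLLLReduced L := by
  obtain ⟨k, bas⟩ := Submodule.basisOfPid (Pi.basisFun ℤ ι) Λ
  let L : Matrix (Fin k) ι ℤ := fun i => (bas i : ι → ℤ)
  have hspan : rowLattice L = Λ := by
    have h := congrArg (Submodule.map Λ.subtype) bas.span_eq
    rw [Submodule.map_span, ← Set.range_comp, Submodule.map_top, Submodule.range_subtype] at h
    exact h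
  have hind : LinearIndependent ℤ L.row :=
    bas.linearIndependent.map' Λ.subtype (Submodule.ker_subtype Λ)
  obtain ⟨L', h1, h2⟩ := exists_isLLLReduced_of_linearIndependent L hind
  exact ⟨k, L', h1.trans hspan, h2⟩

theorem gs_submatrix_castSucc (L : Matrix (Fin (k + 1)) ι ℤ) (i : Fin k) :
    gs (L.submatrix Fin.castSucc id) i = gs L i.castSucc :=
  gramSchmidt_castSucc (rowVec L) i

theorem mu_submatrix_castSucc (L : Matrix (Fin (k + 1)) ι ℤ) (i j : Fin k) :
    mu (L.submatrix Fin.castSucc id) i j = mu L i.castSucc j.castSucc := by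
  rw [mu, gs_submatrix_castSucc]
  rfl

theorem IsLLLReduced.submatrix_castSucc {L : Matrix (Fin (k + 1)) ι ℤ} (hL : IsLLLReduced L) :
    IsLLLReduced (L.submatrix Fin.castSucc id) where
  indep := hL.indep.comp Fin.castSucc (Fin.castSucc_injective k)
  size i j hji := by
    rw [mu_submatrix_castSucc]
    exact hL.size _ _ hji
  lovasz i j hij := by
    rw [mu_submatrix_castSucc, gs_submatrix_castSucc, gs_submatrix_castSucc]
    exact hL.lovasz _ _ hij

/-- LLL-with-removals can always be carried out. -/
theorem exists_lllWithRemovals (b : ℝ) {κ : Type} (A : Matrix κ ι ℤ) :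
    ∃ (k : ℕ) (L : Matrix (Fin k) ι ℤ), LLLWithRemovals b A L := by
  obtain ⟨k, L, hL, hred⟩ := exists_isLLLReduced (rowLattice A)
  have hstart : Relation.ReflTransGen (Removal b) (rowLattice A) (rowLattice L) := by rw [hL]
  clear hL
  induction k with
  | zero => exact ⟨0, L, hstart, hred, fun i => i.elim0⟩
  | succ k ih =>
    -- If the last length exceeds b, dropping the last row is a legal removal and leaves a reduced
    -- basis with one row fewer.
    by_cases hlast : ‖gs L (Fin.last k)‖ ≤ b
    · refine ⟨k + 1, L, hstart, hred, fun i hi => ?_⟩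
      rwa [show i = Fin.last k from Fin.ext (by simpa using hi)]
    · exact ih _ hred.submatrix_castSucc
        (hstart.tail (Removal.mk L hred.indep (not_le.1 hlast)))

theorem Removal.le {b : ℝ} {Λ Λ' : Submodule ℤ (ι → ℤ)} (h : Removal b Λ Λ') : Λ' ≤ Λ := by
  cases h with
  | mk M indep large =>
    refine Submodule.span_mono ?_
    rintro _ ⟨i, rfl⟩
    exact ⟨i.castSucc, rfl⟩

theorem LLLWithRemovals.rowLattice_le {b : ℝ} {κ : Type} {A : Matrix κ ι ℤ}
    {L : Matrix (Fin k) ι ℤ} (h : LLLWithRemovals b A L) : rowLattice L ≤ rowLattice A := by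
  have key : ∀ {Λ}, Relation.ReflTransGen (Removal b) (rowLattice A) Λ → Λ ≤ rowLattice A := by
    intro Λ hΛ
    induction hΛ with
    | refl => exact le_rfl
    | tail _ h ih => exact h.le.trans ih
  exact key h.1

end Existence

/-! ### Discriminants and good primes -/

theorem natDegree_toQ (f : ℤ[X]) : (toQ f).natDegree = f.natDegree :=
  natDegree_map_eq_of_injective Int.cast_injective f

theorem natDegree_pos_of_irreducible {f : ℤ[X]} (hf : Irreducible (toQ f)) : 0 < f.natDegree :=
  natDegree_toQ f ▸ hf.natDegree_pos

/-- The resultant of f and f' is ± the leading coefficient times the discriminant, and it lies in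
the ideal (f, f'). This identity is what makes f' a unit at roots of f for good primes, both modulo
p and over ℤ_p. -/
theorem exists_bezout_discr {f : ℤ[X]} (hf : 0 < f.natDegree) :
    ∃ u v : ℤ[X], f * u + derivative f * v = C (f.leadingCoeff * f.discr) := by
  obtain ⟨u, v, -, -, h⟩ := exists_mul_add_mul_eq_C_resultant f (derivative f) le_rfl
    (natDegree_derivative_le f) (Or.inl hf.ne')
  rw [resultant_deriv (natDegree_pos_iff_degree_pos.1 hf)] at h
  set s : ℤ := (-1) ^ (f.natDegree * (f.natDegree - 1) / 2) with hs
  have hs1 : s * s = 1 := by rw [hs, ← mul_pow]; simp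
  refine ⟨C s * u, C s * v, ?_⟩
  calc _ = C s * (f * u + derivative f * v) := by ring
    _ = C (s * s * (f.leadingCoeff * f.discr)) := by rw [h, ← C_mul]; congr 1; ring
    _ = _ := by rw [hs1, one_mul]

/-- An irreducible polynomial over ℚ is separable, so its resultant with its derivative cannot
vanish. -/
theorem discr_ne_zero {f : ℤ[X]} (hf : Irreducible (toQ f)) : f.discr ≠ 0 := by
  intro h0
  have hn := natDegree_pos_of_irreducible hf
  have h := resultant_deriv (natDegree_pos_iff_degree_pos.1 hn)
  rw [h0, mul_zero] at h
  have h2 := resultant_map_map f (derivative f) f.natDegree (f.natDegree - 1)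
    (Int.castRingHom ℚ)
  have hd : (derivative (toQ f)).natDegree = f.natDegree - 1 := by
    rw [natDegree_derivative, natDegree_toQ]
  rw [h, map_zero, ← derivative_map, ← hd, ← natDegree_toQ f] at h2
  exact (resultant_eq_zero_iff.1 h2).2 hf.separable

theorem leadingCoeff_ne_zero_of_irreducible {f : ℤ[X]} (hf : Irreducible (toQ f)) :
    f.leadingCoeff ≠ 0 := by
  intro h
  rw [leadingCoeff_eq_zero] at h
  exact hf.ne_zero (by simp [toQ, h])

theorem le_natAbs_of_dvd {q : ℕ} {k : ℤ} (hk : k ≠ 0) (h : (q : ℤ) ∣ k) : q ≤ k.natAbs :=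
  Nat.le_of_dvd (Int.natAbs_pos.2 hk) (Int.natCast_dvd.1 h)

theorem exists_bound_not_isGood {f g : ℤ[X]} (hf : Irreducible (toQ f))
    (hg : Irreducible (toQ g)) : ∃ B : ℕ, ∀ q : Nat.Primes, ¬ IsGood f g q → (q : ℕ) ≤ B := by
  refine ⟨f.leadingCoeff.natAbs + g.leadingCoeff.natAbs + f.discr.natAbs + g.discr.natAbs,
    fun q hq => ?_⟩
  by_contra! hlt
  refine hq ⟨fun h => ?_, fun h => ?_, fun h => ?_, fun h => ?_⟩
  · have := le_natAbs_of_dvd (leadingCoeff_ne_zero_of_irreducible hf) h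
    omega
  · have := le_natAbs_of_dvd (leadingCoeff_ne_zero_of_irreducible hg) h
    omega
  · have := le_natAbs_of_dvd (discr_ne_zero hf) h
    omega
  · have := le_natAbs_of_dvd (discr_ne_zero hg) h
    omega

/-- A non-constant integer polynomial has roots modulo infinitely many primes. -/
theorem exists_prime_gt_dvd_eval {f : ℤ[X]} (hf : 0 < f.natDegree) (N : ℕ) :
    ∃ p : ℕ, p.Prime ∧ N < p ∧ ∃ m : ℤ, (p : ℤ) ∣ f.eval m := by
  by_cases h0 : f.eval 0 = 0
  · obtain ⟨p, hp, hprime⟩ := Nat.exists_infinite_primes (N + 1)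
    exact ⟨p, hprime, hp, 0, by rw [h0]; exact dvd_zero _⟩
  set c : ℤ := f.eval 0 with hc
  -- Euclid's argument: with c = f(0), one has f(cMt) = cF where F ≡ 1 mod N!, so no prime up to N
  -- divides F. The point t is chosen so that F ≠ ±1; should F be 0, `minFac` returns 2, which still
  -- divides F.
  set M : ℤ := (N.factorial : ℤ) with hM
  have hM0 : M ≠ 0 := by rw [hM]; exact_mod_cast N.factorial_ne_zero
  have hfin : ∀ d : ℤ, {t : ℤ | f.eval (c * M * t) = d}.Finite := by
    intro d
    have hne : f - C d ≠ 0 := fun h => by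
      rw [sub_eq_zero.1 h, natDegree_C] at hf
      exact lt_irrefl _ hf
    have h1 : {x : ℤ | IsRoot (f - C d) x}.Finite := finite_setOfPred_isRoot hne
    refine (h1.preimage (f := fun t : ℤ => c * M * t) ?_).subset ?_
    · exact fun x _ y _ hxy => mul_left_cancel₀ (mul_ne_zero h0 hM0) hxy
    · intro t ht
      simpa [sub_eq_zero] using ht
  obtain ⟨t, ht⟩ := ((hfin c).union (hfin (-c))).exists_notMem
  simp only [Set.mem_union, Set.mem_ofPred_eq, not_or] at ht
  set F : ℤ := 1 + M * t * f.divX.eval (c * M * t) with hF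
  have hfF : f.eval (c * M * t) = c * F := by
    conv_lhs => rw [← divX_mul_X_add f]
    rw [eval_add, eval_mul, eval_X, eval_C, coeff_zero_eq_eval_zero, ← hc, hF]
    ring
  have hF1 : F.natAbs ≠ 1 := by
    intro h
    rcases Int.natAbs_eq F with h' | h' <;> rw [h] at h' <;> rw [hfF, h'] at ht <;> simp at ht
  refine ⟨F.natAbs.minFac, Nat.minFac_prime hF1, ?_, c * M * t, ?_⟩
  · by_contra! hle
    have hp := Nat.minFac_prime hF1
    have h1 : ((F.natAbs.minFac : ℕ) : ℤ) ∣ F := Int.natCast_dvd.2 (Nat.minFac_dvd _)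
    have h2 : ((F.natAbs.minFac : ℕ) : ℤ) ∣ M := by
      rw [hM]
      exact_mod_cast hp.dvd_factorial.2 hle
    have h3 : ((F.natAbs.minFac : ℕ) : ℤ) ∣ 1 := by
      have h3 := dvd_sub h1 (dvd_mul_of_dvd_left h2 (t * f.divX.eval (c * M * t)))
      have h4 : F - M * (t * f.divX.eval (c * M * t)) = 1 := by rw [hF]; ring
      rwa [h4] at h3
    exact hp.one_lt.ne' (by simpa using Int.natCast_dvd.1 h3)
  · rw [hfF]
    exact dvd_mul_of_dvd_right (Int.natCast_dvd.2 (Nat.minFac_dvd _)) _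

theorem norm_intCast_eq_one {p : ℕ} [Fact p.Prime] {k : ℤ} (h : ¬ (p : ℤ) ∣ k) :
    ‖(k : ℤ_[p])‖ = 1 :=
  le_antisymm (PadicInt.norm_le_one _) (
    not_lt.1 fun h' => h (PadicInt.norm_int_lt_one_iff_dvd k |>.1 h'))

/-- Hensel's lemma: by the Bézout identity for the discriminant, a root modulo p is simple. -/
theorem exists_padic_root {f : ℤ[X]} (hf : 0 < f.natDegree) (p : Nat.Primes)
    (hlc : ¬ ((p : ℕ) : ℤ) ∣ f.leadingCoeff) (hdiscr : ¬ ((p : ℕ) : ℤ) ∣ f.discr)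
    {m : ℤ} (hm : ((p : ℕ) : ℤ) ∣ f.eval m) : ∃ x : ℚ_[(p : ℕ)], aeval x f = 0 := by
  have haeval : ∀ h : ℤ[X], aeval (m : ℤ_[(p : ℕ)]) h = ((h.eval m : ℤ) : ℤ_[(p : ℕ)]) := fun h => by
    have := aeval_algebraMap_apply ℤ_[(p : ℕ)] m h
    simpa using this
  have hder : ¬ ((p : ℕ) : ℤ) ∣ (derivative f).eval m := by
    intro hd
    obtain ⟨u, v, huv⟩ := exists_bezout_discr hf
    have h1 := congrArg (eval m) huv
    rw [eval_add, eval_mul, eval_mul, eval_C] at h1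
    have h2 : ((p : ℕ) : ℤ) ∣ f.leadingCoeff * f.discr :=
      h1 ▸ dvd_add (dvd_mul_of_dvd_left hm _) (dvd_mul_of_dvd_left hd _)
    exact ((Nat.prime_iff_prime_int.1 p.2).dvd_or_dvd h2).elim hlc hdiscr
  have hnorm : ‖aeval (m : ℤ_[(p : ℕ)]) f‖ < ‖aeval (m : ℤ_[(p : ℕ)]) (derivative f)‖ ^ 2 := by
    rw [haeval, haeval, norm_intCast_eq_one hder, one_pow]
    exact (PadicInt.norm_int_lt_one_iff_dvd _).2 hm
  obtain ⟨z, hz, -⟩ := hensels_lemma hnorm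
  refine ⟨(z : ℚ_[(p : ℕ)]), ?_⟩
  have := aeval_algebraMap_apply ℚ_[(p : ℕ)] z f
  rw [hz, map_zero] at this
  exact this

/-! ### Integrality of the values at the roots -/

section Integrality

variable {p : Nat.Primes} {K : Type} [Field K] [Algebra ℤ_[(p : ℕ)] K]

theorem isIntegral_of_unit_mul {u x : K} {k : ℤ} (hk : ¬ ((p : ℕ) : ℤ) ∣ k)
    (hu : IsIntegral ℤ_[(p : ℕ)] u) (h : (k : K) * x = u) : IsIntegral ℤ_[(p : ℕ)] x := by
  obtain ⟨w, hw⟩ := (PadicInt.isUnit_iff.2 (norm_intCast_eq_one hk) : IsUnit (k : ℤ_[(p : ℕ)]))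
  have h1 : x = algebraMap ℤ_[(p : ℕ)] K (↑w⁻¹ : ℤ_[(p : ℕ)]) * u := by
    rw [← h, ← mul_assoc]
    have h2 : (k : K) = algebraMap ℤ_[(p : ℕ)] K w := by rw [hw, map_intCast]
    rw [h2, ← map_mul, Units.inv_mul, map_one, one_mul]
  rw [h1]
  exact isIntegral_algebraMap.mul hu

theorem isIntegral_root {f : ℤ[X]} (hlc : ¬ ((p : ℕ) : ℤ) ∣ f.leadingCoeff) {x : K}
    (hx : aeval x f = 0) : IsIntegral ℤ_[(p : ℕ)] x := by
  have h := (isIntegral_leadingCoeff_smul f x hx).tower_top (A := ℤ_[(p : ℕ)])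
  exact isIntegral_of_unit_mul hlc h (zsmul_eq_mul _ _).symm

theorem isIntegral_aeval {x : K} (hx : IsIntegral ℤ_[(p : ℕ)] x) (h : ℤ[X]) :
    IsIntegral ℤ_[(p : ℕ)] (aeval x h) := by
  rw [aeval_eq_sum_range]
  exact IsIntegral.sum _ fun i _ => (hx.pow i).zsmul _

/-- At a root the Bézout identity reads f'(x) v(x) = (leading coefficient) · (discriminant), a unit
of ℤ_p. This controls the denominator f'(α) of the basis. -/
theorem isIntegral_inv_derivative [CharZero K] {f : ℤ[X]} (hf : 0 < f.natDegree)
    (hlc : ¬ ((p : ℕ) : ℤ) ∣ f.leadingCoeff) (hdiscr : ¬ ((p : ℕ) : ℤ) ∣ f.discr) {x : K}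
    (hx : aeval x f = 0) :
    aeval x (derivative f) ≠ 0 ∧ IsIntegral ℤ_[(p : ℕ)] (aeval x (derivative f))⁻¹ := by
  obtain ⟨u, v, huv⟩ := exists_bezout_discr hf
  have h1 := congrArg (aeval x) huv
  rw [map_add, map_mul, map_mul, hx, zero_mul, zero_add, aeval_C] at h1
  have hnd : ¬ ((p : ℕ) : ℤ) ∣ f.leadingCoeff * f.discr := fun h =>
    ((Nat.prime_iff_prime_int.1 p.2).dvd_or_dvd h).elim hlc hdiscr
  have hne : aeval x (derivative f) ≠ 0 := by
    intro h0
    rw [h0, zero_mul, eq_comm, eq_intCast, Int.cast_eq_zero] at h1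
    exact hnd (h1 ▸ dvd_zero _)
  refine ⟨hne, isIntegral_of_unit_mul hnd (isIntegral_aeval (isIntegral_root hlc hx) v) ?_⟩
  rw [eq_intCast] at h1
  rw [← h1]
  field_simp

end Integrality

/-! ### Values of the basis elements -/

section Base

theorem mk_rep (f : ℤ[X]) (z : NF f) : AdjoinRoot.mk (toQ f) (rep f z) = z := by
  have h := Function.surjInv_eq (AdjoinRoot.mk_surjective (g := toQ f)) z
  conv_rhs => rw [← h]
  rw [rep, AdjoinRoot.mk_eq_mk]
  exact ⟨-(Function.surjInv AdjoinRoot.mk_surjective z / toQ f), by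
    have := EuclideanDomain.div_add_mod (Function.surjInv AdjoinRoot.mk_surjective z) (toQ f)
    linear_combination this⟩

theorem aeval_toQ {K : Type} [Field K] [Algebra ℚ K] (f : ℤ[X]) (x : K) :
    aeval x (toQ f) = aeval x f := aeval_map_algebraMap (R := ℤ) ℚ x f

theorem aeval_eq_of_mk_eq {f : ℤ[X]} {K : Type} [Field K] [Algebra ℚ K] {x : K}
    (hx : aeval x f = 0) {h₁ h₂ : ℚ[X]} (h : AdjoinRoot.mk (toQ f) h₁ = AdjoinRoot.mk (toQ f) h₂) :
    aeval x h₁ = aeval x h₂ := by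
  obtain ⟨r, hr⟩ := AdjoinRoot.mk_eq_mk.1 h
  have := congrArg (aeval x) hr
  rwa [map_mul, aeval_toQ, hx, zero_mul, map_sub, sub_eq_zero] at this

theorem aeval_rep_root {g : ℤ[X]} {K : Type} [Field K] [Algebra ℚ K] {x : K}
    (hx : aeval x g = 0) : aeval x (rep g (AdjoinRoot.root (toQ g))) = x := by
  have := aeval_eq_of_mk_eq hx (h₂ := X) ((mk_rep g _).trans AdjoinRoot.mk_X.symm)
  rwa [aeval_X] at this

theorem aeval_root_eq_mk (f h : ℤ[X]) :
    aeval (AdjoinRoot.root (toQ f)) h = AdjoinRoot.mk (toQ f) (toQ h) := by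
  have : (aeval (AdjoinRoot.root (toQ f)) : ℤ[X] →ₐ[ℤ] NF f).toRingHom =
      (AdjoinRoot.mk (toQ f)).comp (mapRingHom (Int.castRingHom ℚ)) := by
    refine Polynomial.ringHom_ext' (RingHom.ext_int _ _) ?_
    change aeval _ X = AdjoinRoot.mk _ (X.map _)
    rw [aeval_X, Polynomial.map_X, AdjoinRoot.mk_X]
  exact congrArg (fun φ : ℤ[X] →+* NF f => φ h) this

variable (f : ℤ[X]) [hfact : Fact (Irreducible (toQ f))]

theorem aeval_root_derivative_ne_zero :
    aeval (AdjoinRoot.root (toQ f)) (derivative f) ≠ 0 := by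
  intro h
  have h1 : AdjoinRoot.mk (toQ f) (derivative (toQ f)) = 0 := by
    rw [derivative_map]
    exact (aeval_root_eq_mk f _).symm.trans h
  have h2 := eq_zero_of_dvd_of_degree_lt (AdjoinRoot.mk_eq_zero.1 h1)
    (degree_derivative_lt hfact.out.ne_zero)
  exact hfact.out.natDegree_pos.ne' (Polynomial.derivative_eq_zero.1 h2)

theorem base_mul_derivative (i : Fin f.natDegree) :
    base f i * aeval (AdjoinRoot.root (toQ f)) (derivative f) =
      AdjoinRoot.root (toQ f) ^ (i : ℕ) := by
  rw [base, rho, div_mul_cancel₀ _ (aeval_root_derivative_ne_zero f)]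
  rw [Finset.sum_eq_single i]
  · simp
  · intro j _ hj
    simp [hj]
  · simp

theorem aeval_rep_base {K : Type} [Field K] [Algebra ℚ K] {x : K} (hx : aeval x f = 0)
    (i : Fin f.natDegree) :
    aeval x (rep f (base f i)) * aeval x (derivative f) = x ^ (i : ℕ) := by
  have h : AdjoinRoot.mk (toQ f) (rep f (base f i) * toQ (derivative f)) =
      AdjoinRoot.mk (toQ f) (X ^ (i : ℕ)) := by
    rw [map_mul, mk_rep, ← aeval_root_eq_mk, base_mul_derivative, map_pow, AdjoinRoot.mk_X]
  have := aeval_eq_of_mk_eq hx h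
  rwa [map_mul, aeval_toQ, map_pow, aeval_X] at this

/-- The values of the basis elements at a root are linearly independent over the integers. -/
theorem eq_zero_of_sum_aeval_base {K : Type} [Field K] [Algebra ℚ K] {x : K}
    (hx : aeval x f = 0) (w : Fin f.natDegree → ℤ)
    (hw : ∑ i, (w i : K) * aeval x (rep f (base f i)) = 0) : w = 0 := by
  -- Multiplying the relation by f'(x) turns it into W(x) = 0 with deg W < n, which contradicts the
  -- degree of the minimal polynomial of x unless W = 0.
  let W : ℚ[X] := ∑ i : Fin f.natDegree, C (w i : ℚ) * X ^ (i : ℕ)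
  have hW : aeval x W = 0 := by
    have : aeval x W = (∑ i, (w i : K) * aeval x (rep f (base f i))) * aeval x (derivative f) := by
      rw [Finset.sum_mul, map_sum]
      refine Finset.sum_congr rfl fun i _ => ?_
      rw [mul_assoc, aeval_rep_base f hx, map_mul, map_pow, aeval_X, aeval_C, map_intCast]
    rw [this, hw, zero_mul]
  have hdvd : toQ f ∣ W := by
    have h1 := minpoly.eq_of_irreducible hfact.out (show aeval x (toQ f) = 0 by rw [aeval_toQ, hx])
    exact (Dvd.intro _ h1).trans (minpoly.dvd ℚ x hW)
  have hdeg : W.degree < (toQ f).degree := by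
    rw [degree_eq_natDegree hfact.out.ne_zero, natDegree_toQ]
    exact degree_sum_fin_lt fun i => (w i : ℚ)
  have hW0 : W = 0 := eq_zero_of_dvd_of_degree_lt hdvd hdeg
  funext i
  have h2 := congrArg (fun q : ℚ[X] => q.coeff i) hW0
  simp only [W, finsetSum_coeff, coeff_C_mul, coeff_X_pow, coeff_zero] at h2
  rw [Finset.sum_eq_single i] at h2
  · simpa using h2
  · intro j _ hj
    have : (i : ℕ) ≠ j := fun h => hj (Fin.ext h.symm)
    simp [this]
  · simp

end Base

/-! ### Distinct degree factors -/

section DistinctDegree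

open UniqueFactorizationMonoid

variable {p : Nat.Primes} {f : ℤ[X]}

theorem map_padic_ne_zero (hf : f ≠ 0) : f.map (Int.castRingHom ℚ_[(p : ℕ)]) ≠ 0 :=
  (Polynomial.map_ne_zero_iff Int.cast_injective).2 hf

theorem ddFactor_dvd (hf : f ≠ 0) (d : ℕ) :
    ddFactor p f d ∣ f.map (Int.castRingHom ℚ_[(p : ℕ)]) := by
  classical
  refine dvd_trans ?_ (prod_normalizedFactors (map_padic_ne_zero hf)).dvd
  exact Multiset.prod_dvd_prod_of_le (Multiset.filter_le _ _)

theorem ddFactor_ne_zero (hf : f ≠ 0) (d : ℕ) : ddFactor p f d ≠ 0 := fun h =>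
  map_padic_ne_zero hf (zero_dvd_iff.1 (h ▸ ddFactor_dvd hf d))

theorem aeval_eq_zero_of_mem_aroots (hf : f ≠ 0) {K : Type} [Field K] [Algebra ℚ_[(p : ℕ)] K]
    {d : ℕ} {x : K} (hx : x ∈ (ddFactor p f d).aroots K) : aeval x f = 0 := by
  have h1 := aeval_eq_zero_of_dvd_aeval_eq_zero (ddFactor_dvd hf d) (mem_aroots.1 hx).2
  rwa [← algebraMap_int_eq, aeval_map_algebraMap] at h1

theorem aeval_eq_zero_of_mem_roots (hf : f ≠ 0) {d : ℕ} {x : ℚ_[(p : ℕ)]}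
    (hx : x ∈ (ddFactor p f d).roots) : aeval x f = 0 :=
  by
  refine aeval_eq_zero_of_mem_aroots (p := p) (d := d) hf ?_
  rwa [aroots_def, Algebra.algebraMap_self, Polynomial.map_id]

open Classical in
theorem natDegree_ddFactor (d : ℕ) : (ddFactor p f d).natDegree =
    (((normalizedFactors (f.map (Int.castRingHom ℚ_[(p : ℕ)]))).filter
      (fun P => P.natDegree = d)).map natDegree).sum :=
  natDegree_multiset_prod _ fun h => zero_notMem_normalizedFactors _ (Multiset.mem_filter.1 h).1

open Classical in
theorem natDegree_ddFactor_pos_iff {d : ℕ} : 0 < (ddFactor p f d).natDegree ↔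
    ∃ P ∈ normalizedFactors (f.map (Int.castRingHom ℚ_[(p : ℕ)])), P.natDegree = d := by
  rw [natDegree_ddFactor, pos_iff_ne_zero, Ne, Multiset.sum_eq_zero_iff]
  push Not
  constructor
  · rintro ⟨n, hn, -⟩
    obtain ⟨P, hP, rfl⟩ := Multiset.mem_map.1 hn
    exact ⟨P, Multiset.mem_filter.1 hP⟩
  · rintro ⟨P, hP, hd⟩
    exact ⟨_, Multiset.mem_map_of_mem _ (Multiset.mem_filter.2 ⟨hP, hd⟩),
      (irreducible_of_normalized_factor P hP).natDegree_pos.ne'⟩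

open Classical in
theorem finite_ddDegrees (p : Nat.Primes) (f : ℤ[X]) : (ddDegrees p f).Finite := by
  refine ((Multiset.finite_toSet (normalizedFactors
    (f.map (Int.castRingHom ℚ_[(p : ℕ)])))).image natDegree).subset fun d hd => ?_
  obtain ⟨P, hP, rfl⟩ := natDegree_ddFactor_pos_iff.1 hd
  exact ⟨P, hP, rfl⟩

open Classical in
theorem natDegree_ddFactor_one_pos (hf : f ≠ 0) {x : ℚ_[(p : ℕ)]} (hx : aeval x f = 0) :
    0 < (ddFactor p f 1).natDegree := by
  have hdvd : X - C x ∣ f.map (Int.castRingHom ℚ_[(p : ℕ)]) := by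
    rw [dvd_iff_isRoot, IsRoot.def, eval_map, ← algebraMap_int_eq]
    exact hx
  obtain ⟨q, hq, hass⟩ := exists_mem_normalizedFactors_of_dvd (map_padic_ne_zero hf)
    (irreducible_X_sub_C x) hdvd
  refine natDegree_ddFactor_pos_iff.2 ⟨q, hq, ?_⟩
  rw [← natDegree_eq_of_degree_eq (degree_eq_degree_of_associated hass), natDegree_X_sub_C]

open Classical in
theorem exists_mem_roots_ddFactor_one (hf : f ≠ 0) (h : 0 < (ddFactor p f 1).natDegree) :
    ∃ x, x ∈ (ddFactor p f 1).roots := by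
  obtain ⟨P, hP, hd⟩ := natDegree_ddFactor_pos_iff.1 h
  obtain ⟨x, hx⟩ := exists_root_of_degree_eq_one
    ((degree_eq_iff_natDegree_eq_of_pos one_pos).2 hd)
  refine ⟨x, (mem_roots (ddFactor_ne_zero hf 1)).2 (hx.dvd ?_)⟩
  exact Multiset.dvd_prod (Multiset.mem_filter.2 ⟨hP, hd⟩)

end DistinctDegree

/-! ### Residues -/

section Residues

variable {p : Nat.Primes}

theorem exists_isResidue {K : Type} [Field K] [Algebra ℚ_[(p : ℕ)] K] [Algebra ℤ_[(p : ℕ)] K]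
    [IsScalarTower ℤ_[(p : ℕ)] ℚ_[(p : ℕ)] K] (a : ℕ) {s : K}
    (hs : IsIntegral ℤ_[(p : ℕ)] s) (hrange : s ∈ Set.range (algebraMap ℚ_[(p : ℕ)] K)) :
    ∃ t : ℤ, IsResidue p a s t := by
  obtain ⟨y, rfl⟩ := hrange
  rw [isIntegral_algebraMap_iff (algebraMap ℚ_[(p : ℕ)] K).injective,
    IsIntegrallyClosed.isIntegral_iff] at hs
  obtain ⟨z, rfl⟩ := hs
  obtain ⟨t, ht⟩ := ZMod.intCast_surjective (PadicInt.toZModPow a z)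
  exact ⟨t, z, rfl, ht⟩

theorem isIntegral_aeval_rep_base {f : ℤ[X]} [hfact : Fact (Irreducible (toQ f))]
    (hlc : ¬ ((p : ℕ) : ℤ) ∣ f.leadingCoeff) (hdiscr : ¬ ((p : ℕ) : ℤ) ∣ f.discr)
    {K : Type} [Field K] [Algebra ℚ K] [Algebra ℤ_[(p : ℕ)] K] {x : K} (hx : aeval x f = 0)
    (i : Fin f.natDegree) : IsIntegral ℤ_[(p : ℕ)] (aeval x (rep f (base f i))) := by
  have : CharZero K := algebraRat.charZero K
  obtain ⟨hne, hint⟩ := isIntegral_inv_derivative (natDegree_pos_of_irreducible hfact.out)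
    hlc hdiscr hx
  rw [(eq_mul_inv_iff_mul_eq₀ hne).2 (aeval_rep_base f hx i)]
  exact ((isIntegral_root hlc hx).pow _).mul hint

/-- Automorphisms over ℚ_p permute the roots of F_d and fix the rational coefficients of the
representing polynomial, so the sum is Galois invariant. -/
theorem subTrace_mem_range (f : ℤ[X]) (d : ℕ) (z : NF f) :
    subTrace p f d z ∈ Set.range (algebraMap ℚ_[(p : ℕ)] (AlgebraicClosure ℚ_[(p : ℕ)])) := by
  rw [InfiniteGalois.mem_range_algebraMap_iff_fixed]
  intro σ
  let σ' : AlgebraicClosure ℚ_[(p : ℕ)] →+* AlgebraicClosure ℚ_[(p : ℕ)] := σ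
  set P := (ddFactor p f d).map (algebraMap ℚ_[(p : ℕ)] (AlgebraicClosure ℚ_[(p : ℕ)])) with hP
  have hroots : P.roots.map σ = P.roots := by
    have h1 := (IsAlgClosed.splits P).roots_map σ'
    rw [hP, Polynomial.map_map, ← hP] at h1
    have h2 : σ'.comp
        (algebraMap ℚ_[(p : ℕ)] (AlgebraicClosure ℚ_[(p : ℕ)])) = algebraMap _ _ :=
      RingHom.ext fun y => σ.commutes y
    rw [h2, ← hP] at h1
    exact h1.symm
  have hval : ∀ γ, σ (aeval γ (rep f z)) = aeval (σ γ) (rep f z) := fun γ => by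
    rw [aeval_def, aeval_def]
    refine (hom_eval₂ _ _ σ' _).trans ?_
    congr 1
    exact Subsingleton.elim _ _
  rw [subTrace, map_multiset_sum, Multiset.map_map]
  change (P.roots.map fun γ => σ (aeval γ (rep f z))).sum =
    (P.roots.map fun γ => aeval γ (rep f z)).sum
  simp_rw [hval]
  conv_rhs => rw [← hroots, Multiset.map_map]
  rfl

theorem isIntegral_subTrace {f : ℤ[X]} (hf : f ≠ 0) {d : ℕ} {z : NF f}
    (h : ∀ x : AlgebraicClosure ℚ_[(p : ℕ)], aeval x f = 0 →
      IsIntegral ℤ_[(p : ℕ)] (aeval x (rep f z))) :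
    IsIntegral ℤ_[(p : ℕ)] (subTrace p f d z) := by
  refine IsIntegral.multiset_sum fun y hy => ?_
  obtain ⟨x, hx, rfl⟩ := Multiset.mem_map.1 hy
  exact h x (aeval_eq_zero_of_mem_aroots hf hx)

variable {f g : ℤ[X]} [hfact : Fact (Irreducible (toQ f))]

theorem ne_zero_of_irreducible {f : ℤ[X]} (hf : Irreducible (toQ f)) : f ≠ 0 :=
  ne_zero_of_natDegree_gt (natDegree_pos_of_irreducible hf)

theorem exists_isTraceMatrix (hg : Irreducible (toQ g)) (good : IsGood f g p) (a : ℕ) :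
    ∃ (m : ℕ) (T : Matrix (Fin (f.natDegree + 1)) (Fin m) ℤ), IsTraceMatrix f g p a T := by
  let s := (finite_ddDegrees p f).toFinset
  let ds := s.orderEmbOfFin rfl
  have h1 : ∀ j i, ∃ t : ℤ, IsResidue p a (subTrace p f (ds j) (base f i)) t := fun j i =>
    exists_isResidue a (isIntegral_subTrace (ne_zero_of_irreducible hfact.out) fun x hx =>
      isIntegral_aeval_rep_base good.1 good.2.2.1 hx i) (subTrace_mem_range f _ _)
  have h2 : ∀ j, ∃ t : ℤ, IsResidue p a (subTrace p g (ds j) (AdjoinRoot.root (toQ g))) t :=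
    fun j => exists_isResidue a (isIntegral_subTrace (ne_zero_of_irreducible hg) fun x hx => by
      rw [aeval_rep_root hx]
      exact isIntegral_root good.2.1 hx) (subTrace_mem_range g _ _)
  choose t ht using h1
  choose u hu using h2
  refine ⟨s.card, fun i j => Fin.lastCases (motive := fun _ => ℤ) (u j) (t j) i, ds,
    ds.strictMono, ?_, fun j => ⟨fun i => ?_, ?_⟩⟩
  · rw [Finset.range_orderEmbOfFin]
    exact (finite_ddDegrees p f).coe_toFinset
  · simpa only [Fin.lastCases_castSucc] using ht j i
  · simpa only [Fin.lastCases_last] using hu j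

theorem exists_isRootMatrix (good : IsGood f g p) (a : ℕ) {x y : ℚ_[(p : ℕ)]}
    (hx : aeval x f = 0) (hy : aeval y g = 0) :
    ∃ T : Matrix (Fin (f.natDegree + 1)) (Fin 1) ℤ, IsRootMatrix f p a x y T := by
  have h1 : ∀ i, ∃ t : ℤ, IsResidue p a (aeval x (rep f (base f i))) t := fun i =>
    exists_isResidue a (isIntegral_aeval_rep_base good.1 good.2.2.1 hx i) ⟨_, rfl⟩
  choose t ht using h1
  obtain ⟨u, hu⟩ := exists_isResidue a (isIntegral_root good.2.1 hy) ⟨_, rfl⟩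
  refine ⟨fun i _ => Fin.lastCases (motive := fun _ => ℤ) u t i, fun i => ?_, ?_⟩
  · simpa only [Fin.lastCases_castSucc] using ht i
  · simpa only [Fin.lastCases_last] using hu

/-- The lattice of integer relations among the values of the basis elements at a root and another
number has rank at most one. -/
theorem exists_relation_ne_zero {x y : ℚ_[(p : ℕ)]} (hx : aeval x f = 0) {e : ℕ}
    {C : Matrix (Fin e) (Fin (f.natDegree + 1)) ℤ} (hC : LinearIndependent ℤ C.row) (he : 1 < e) :
    ∃ i, ∑ j, (C i (Fin.castSucc j) : ℚ_[(p : ℕ)]) * aeval x (rep f (base f j)) +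
      (C i (Fin.last _) : ℚ_[(p : ℕ)]) * y ≠ 0 := by
  by_contra! hrel
  have hlast : ∀ c : Fin (f.natDegree + 1) → ℤ, c (Fin.last _) = 0 →
      ∑ j, (c (Fin.castSucc j) : ℚ_[(p : ℕ)]) * aeval x (rep f (base f j)) = 0 → c = 0 := by
    intro c h0 hsum
    have h1 := eq_zero_of_sum_aeval_base f hx (fun j => c (Fin.castSucc j)) hsum
    funext j
    refine Fin.lastCases h0 (fun j => ?_) j
    exact congrFun h1 j
  let i₀ : Fin e := ⟨0, by omega⟩
  let i₁ : Fin e := ⟨1, he⟩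
  have hne : i₀ ≠ i₁ := by simp [i₀, i₁]
  -- Eliminating the coordinate of y from two rows leaves a relation among the basis values alone,
  -- which must be trivial. Independence then forces the last coordinate of row i₀ to be 0, so row
  -- i₀ is itself such a relation.
  have hcomb : C i₁ (Fin.last _) • C i₀ + (-C i₀ (Fin.last _)) • C i₁ = 0 := by
    refine hlast _ ?_ ?_
    · simp only [Pi.add_apply, Pi.smul_apply, smul_eq_mul]
      ring
    · have h0 := hrel i₀
      have h1 := hrel i₁
      have : ∑ j, (((C i₁ (Fin.last _) • C i₀ + (-C i₀ (Fin.last _)) • C i₁) (Fin.castSucc j) : ℤ) :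
          ℚ_[(p : ℕ)]) * aeval x (rep f (base f j)) =
          (C i₁ (Fin.last _) : ℚ_[(p : ℕ)]) *
            ∑ j, (C i₀ (Fin.castSucc j) : ℚ_[(p : ℕ)]) * aeval x (rep f (base f j)) -
          (C i₀ (Fin.last _) : ℚ_[(p : ℕ)]) *
            ∑ j, (C i₁ (Fin.castSucc j) : ℚ_[(p : ℕ)]) * aeval x (rep f (base f j)) := by
        rw [Finset.mul_sum, Finset.mul_sum, ← Finset.sum_sub_distrib]
        refine Finset.sum_congr rfl fun j _ => ?_
        simp only [Pi.add_apply, Pi.smul_apply, smul_eq_mul]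
        push_cast
        ring
      rw [this]
      linear_combination (C i₁ (Fin.last _) : ℚ_[(p : ℕ)]) * h0 -
        (C i₀ (Fin.last _) : ℚ_[(p : ℕ)]) * h1
  have hind : LinearIndependent ℤ ![C i₀, C i₁] := by
    have h := hC.comp ![i₀, i₁] (by
      intro a b hab
      fin_cases a <;> fin_cases b <;> simp_all [hne.symm])
    convert h using 1
    funext a
    fin_cases a <;> rfl
  have hpair := LinearIndependent.pair_iff.1 hind _ _ hcomb
  have h0 : C i₀ (Fin.last _) = 0 := neg_eq_zero.1 hpair.2
  refine hC.ne_zero i₀ (hlast (C i₀) h0 ?_)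
  have := hrel i₀
  rwa [h0, Int.cast_zero, zero_mul, add_zero] at this

/-- A lattice of rank at least two cannot consist of relations modulo arbitrarily high powers
of `p`. -/
theorem exists_not_vanishes (good : IsGood f g p) {x y : ℚ_[(p : ℕ)]} (hx : aeval x f = 0)
    (hy : aeval y g = 0) {e : ℕ} {C : Matrix (Fin e) (Fin (f.natDegree + 1)) ℤ}
    (hC : LinearIndependent ℤ C.row) (he : 1 < e) :
    ∃ N : ℕ, ∀ a ≥ N, ∀ T, IsRootMatrix f p a x y T → ¬ Vanishes C T (((p : ℕ) : ℤ) ^ a) := by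
  obtain ⟨i, hi⟩ := exists_relation_ne_zero (y := y) hx hC he
  have h1 : ∀ j, ∃ z : ℤ_[(p : ℕ)], (z : ℚ_[(p : ℕ)]) = aeval x (rep f (base f j)) := fun j =>
    IsIntegrallyClosed.isIntegral_iff.1 (isIntegral_aeval_rep_base good.1 good.2.2.1 hx j)
  choose z hz using h1
  obtain ⟨w, rfl⟩ : ∃ w : ℤ_[(p : ℕ)], (w : ℚ_[(p : ℕ)]) = y :=
    IsIntegrallyClosed.isIntegral_iff.1 (isIntegral_root good.2.1 hy)
  -- The value of a row that is not an exact relation: a nonzero p-adic integer, hence nonzero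
  -- modulo some p^N and modulo every higher power.
  set s : ℤ_[(p : ℕ)] := ∑ j, (C i (Fin.castSucc j) : ℤ_[(p : ℕ)]) * z j +
    (C i (Fin.last _) : ℤ_[(p : ℕ)]) * w with hs
  have hs0 : s ≠ 0 := by
    intro h0
    apply hi
    have := congrArg (fun t : ℤ_[(p : ℕ)] => (t : ℚ_[(p : ℕ)])) h0
    simp only [hs] at this
    push_cast [PadicInt.coe_sum] at this
    simpa only [hz] using this
  obtain ⟨N, hN⟩ : ∃ N, PadicInt.toZModPow N s ≠ 0 := by
    by_contra! h
    exact hs0 (PadicInt.ext_of_toZModPow.1 fun n => by rw [h n, map_zero])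
  refine ⟨N, fun a ha T hT hv => hN ?_⟩
  have hsa : PadicInt.toZModPow a s = 0 := by
    have hres : ∀ {u : ℤ_[(p : ℕ)]} {t : ℤ}, IsResidue p a (u : ℚ_[(p : ℕ)]) t →
        PadicInt.toZModPow a u = (t : ZMod ((p : ℕ) ^ a)) := by
      rintro u t ⟨v, hv, ht⟩
      rw [ht, Subtype.ext hv]
    have hT1 : ∀ j, PadicInt.toZModPow a (z j) = (T (Fin.castSucc j) 0 : ZMod ((p : ℕ) ^ a)) :=
      fun j => hres (by rw [hz]; exact hT.1 j)
    have h2 : ((C * T) i 0 : ZMod ((p : ℕ) ^ a)) = 0 := by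
      rw [ZMod.intCast_zmod_eq_zero_iff_dvd]
      exact_mod_cast hv i 0
    rw [← h2, Matrix.mul_apply, Fin.sum_univ_castSucc, hs]
    push_cast
    simp only [map_add, map_sum, map_mul, map_intCast, hT1, hres hT.2]
  rw [← PadicInt.zmod_cast_comp_toZModPow N a ha, RingHom.comp_apply, hsa, map_zero]

end Residues

/-! ### Lattices met in a reduction -/

theorem LLLWithRemovals.abs_apply_le {ι κ : Type} [Fintype ι] {k K : ℕ} {b : ℝ} {A : Matrix κ ι ℤ}
    {L : Matrix (Fin k) ι ℤ} (h : LLLWithRemovals b A L) (hk : k ≤ K) (i : Fin k) (j : ι) :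
    |(L i j : ℝ)| ≤ entryBound b K := by
  have hb : 0 ≤ b := (norm_nonneg _).trans (h.2.2 ⟨k - 1, by have := i.pos; omega⟩
    (by have := i.pos; simp; omega))
  refine (h.2.1.abs_apply_le h.2.2 i j).trans ?_
  unfold entryBound
  gcongr
  norm_num

section Reduction

variable {n m : ℕ}

theorem exists_of_mem_rowLattice_scale {k : ℕ} {L : Matrix (Fin k) (Fin n ⊕ Fin m) ℤ}
    {v : Fin n ⊕ Fin m → ℤ} (hv : v ∈ rowLattice (scale L)) :
    ∃ w ∈ rowLattice L, v ∘ Sum.inl = w ∘ Sum.inl ∧ v ∘ Sum.inr = (10 ^ 20 : ℤ) • (w ∘ Sum.inr) := by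
  induction hv using Submodule.span_induction with
  | mem x hx =>
    obtain ⟨i, rfl⟩ := hx
    exact ⟨L i, Submodule.subset_span ⟨i, rfl⟩, rfl, rfl⟩
  | zero => exact ⟨0, Submodule.zero_mem _, rfl, by ext; simp⟩
  | add x y _ _ hx hy =>
    obtain ⟨w, hw, h1, h2⟩ := hx
    obtain ⟨w', hw', h1', h2'⟩ := hy
    refine ⟨w + w', Submodule.add_mem _ hw hw', ?_, ?_⟩
    · rw [Pi.add_comp, h1, h1', Pi.add_comp]
    · rw [Pi.add_comp, h2, h2', Pi.add_comp, smul_add]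
  | smul a x _ hx =>
    obtain ⟨w, hw, h1, h2⟩ := hx
    refine ⟨a • w, Submodule.smul_mem _ _ hw, ?_, ?_⟩
    · rw [Pi.smul_comp, h1, Pi.smul_comp]
    · rw [Pi.smul_comp, h2, Pi.smul_comp, smul_comm]

/-- The sublattice of the vectors `c` with `c T ≡ 0` modulo `q`. -/
def relationLattice {e : ℕ} (C : Matrix (Fin e) (Fin n) ℤ) (T : Matrix (Fin n) (Fin m) ℤ) (q : ℤ) :
    Submodule ℤ (Fin n → ℤ) where
  carrier := {c | c ∈ rowLattice C ∧ ∀ j, q ∣ Matrix.vecMul c T j}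
  zero_mem' := ⟨Submodule.zero_mem _, fun j => by simp⟩
  add_mem' := fun hx hy => ⟨Submodule.add_mem _ hx.1 hy.1, fun j => by
    rw [Matrix.add_vecMul]
    exact dvd_add (hx.2 j) (hy.2 j)⟩
  smul_mem' := fun a x hx => ⟨Submodule.smul_mem _ _ hx.1, fun j => by
    rw [Matrix.smul_vecMul]
    exact dvd_mul_of_dvd_right (hx.2 j) a⟩

theorem relationLattice_lt {e : ℕ} {C : Matrix (Fin e) (Fin n) ℤ} {T : Matrix (Fin n) (Fin m) ℤ}
    {q : ℤ} (h : ¬ Vanishes C T q) : relationLattice C T q < rowLattice C := by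
  refine lt_of_le_of_ne (fun c hc => hc.1) fun heq => h fun i j => ?_
  have hi : C i ∈ relationLattice C T q := heq ▸ Submodule.subset_span ⟨i, rfl⟩
  exact hi.2 j

/-- The vectors `(c, 0)` of the lattice spanned by the rows of `A` have `c ∈ Λ`. -/
def KernelLE {κ : Type} (A : Matrix κ (Fin n ⊕ Fin m) ℤ) (Λ : Submodule ℤ (Fin n → ℤ)) : Prop :=
  ∀ v ∈ rowLattice A, v ∘ Sum.inr = 0 → v ∘ Sum.inl ∈ Λ

/-- Every vector (c, w) of the augmented lattice satisfies w ≡ cT mod q; for w = 0 this is the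
defining congruence of the relation lattice. Removals and scaling preserve the conclusion. -/
theorem kernelLE_augment {e : ℕ} (C : Matrix (Fin e) (Fin n) ℤ) (T : Matrix (Fin n) (Fin m) ℤ)
    (q : ℤ) : KernelLE (augment C T q) (relationLattice C T q) := by
  have key : ∀ v ∈ rowLattice (augment C T q), v ∘ Sum.inl ∈ rowLattice C ∧
      ∀ j, q ∣ Matrix.vecMul (v ∘ Sum.inl) T j - v (Sum.inr j) := by
    intro v hv
    induction hv using Submodule.span_induction with
    | mem x hx =>
      obtain ⟨i, rfl⟩ := hx
      obtain ⟨s, rfl⟩ := finSumFinEquiv.surjective i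
      rcases s with s | s
      · have h1 : (augment C T q).row (finSumFinEquiv (Sum.inl s)) ∘ Sum.inl = C s := by
          ext j
          simp [augment]
        refine ⟨h1 ▸ Submodule.subset_span ⟨s, rfl⟩, fun j => ?_⟩
        have h2 : (augment C T q).row (finSumFinEquiv (Sum.inl s)) (Sum.inr j) = (C * T) s j := by
          simp [augment]
        rw [h1, h2]
        exact ⟨0, by rw [mul_zero]; exact sub_self _⟩
      · have h1 : (augment C T q).row (finSumFinEquiv (Sum.inr s)) ∘ Sum.inl = 0 := by
          ext j
          simp [augment]
        refine ⟨h1 ▸ Submodule.zero_mem _, fun j => ?_⟩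
        have h2 : (augment C T q).row (finSumFinEquiv (Sum.inr s)) (Sum.inr j) =
            q * (1 : Matrix (Fin m) (Fin m) ℤ) s j := by
          simp [augment, -zsmul_eq_mul, -zsmul_one]
        rw [h1, h2, Matrix.zero_vecMul]
        exact ⟨-(1 : Matrix (Fin m) (Fin m) ℤ) s j, by simp⟩
    | zero => exact ⟨Submodule.zero_mem _, fun j => by simp [Pi.zero_comp]⟩
    | add x y _ _ hx hy =>
      refine ⟨Submodule.add_mem _ hx.1 hy.1, fun j => ?_⟩
      rw [Pi.add_comp, Matrix.add_vecMul, Pi.add_apply, Pi.add_apply, add_sub_add_comm]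
      exact dvd_add (hx.2 j) (hy.2 j)
    | smul a x _ hx =>
      refine ⟨Submodule.smul_mem _ _ hx.1, fun j => ?_⟩
      rw [Pi.smul_comp, Matrix.smul_vecMul, Pi.smul_apply, Pi.smul_apply, ← smul_sub]
      exact dvd_mul_of_dvd_right (hx.2 j) a
  intro v hv h0
  refine ⟨(key v hv).1, fun j => ?_⟩
  have := (key v hv).2 j
  rwa [show v (Sum.inr j) = 0 from congrFun h0 j, sub_zero] at this

theorem KernelLE.of_lllWithRemovals {k l : ℕ} {b : ℝ} {A : Matrix (Fin k) (Fin n ⊕ Fin m) ℤ}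
    {Λ : Submodule ℤ (Fin n → ℤ)} (hA : KernelLE A Λ) {L : Matrix (Fin l) (Fin n ⊕ Fin m) ℤ}
    (hL : LLLWithRemovals b A L) : KernelLE L Λ := fun v hv => hA v (hL.rowLattice_le hv)

theorem KernelLE.scale {l : ℕ} {Λ : Submodule ℤ (Fin n → ℤ)}
    {L : Matrix (Fin l) (Fin n ⊕ Fin m) ℤ} (hL : KernelLE L Λ) : KernelLE (scale L) Λ := by
  intro v hv h0
  obtain ⟨w, hw, h1, h2⟩ := exists_of_mem_rowLattice_scale hv
  rw [h1]
  exact hL w hw ((smul_eq_zero_iff_right (by norm_num)).1 (h2.symm.trans h0))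

/-- Scaling and reducing again cannot be repeated forever, since the entries of the output are
bounded while the entries of its second block are divisible by growing powers of `10 ^ 20`. -/
theorem reduction_induction (b : ℝ) (Λ : Submodule ℤ (Fin n → ℤ))
    {P : ∀ {k : ℕ}, Matrix (Fin k) (Fin n ⊕ Fin m) ℤ → Prop}
    (step : ∀ {k : ℕ} (A : Matrix (Fin k) (Fin n ⊕ Fin m) ℤ), KernelLE A Λ →
      (∀ {l : ℕ} (L : Matrix (Fin l) (Fin n ⊕ Fin m) ℤ), LLLWithRemovals b A L →
        L.toCols₂ ≠ 0 → P (scale L)) → P A)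
    {k : ℕ} (A : Matrix (Fin k) (Fin n ⊕ Fin m) ℤ) (hA : KernelLE A Λ) : P A := by
  obtain ⟨N, hN⟩ := pow_unbounded_of_one_lt (entryBound b (Fintype.card (Fin n ⊕ Fin m)))
    (show (1 : ℝ) < 10 ^ 20 by norm_num)
  -- Here t counts the scalings already done and d those still possible. At t = N a nonzero entry of
  -- the second block would have absolute value at least 10^(20N), beyond the bound for a reduced
  -- output.
  have key : ∀ d t : ℕ, t + d = N → ∀ {k : ℕ} (A : Matrix (Fin k) (Fin n ⊕ Fin m) ℤ),
      KernelLE A Λ → (∀ v ∈ rowLattice A, ∀ j, (10 ^ 20 : ℤ) ^ t ∣ v (Sum.inr j)) → P A := by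
    intro d
    induction d with
    | zero =>
      intro t ht k A hA hdvd
      obtain rfl : t = N := ht
      refine step A hA fun {l} L hL hB => absurd ?_ hB
      ext i j
      have hmem : L i ∈ rowLattice A := hL.rowLattice_le (Submodule.subset_span ⟨i, rfl⟩)
      refine Int.eq_zero_of_abs_lt_dvd (hdvd _ hmem j) ?_
      have h1 := (hL.abs_apply_le hL.2.1.card_le i (Sum.inr j)).trans_lt hN
      exact_mod_cast h1
    | succ d ih =>
      intro t ht k A hA hdvd
      refine step A hA fun {l} L hL hB => ih (t + 1) (by omega) _
        (hA.of_lllWithRemovals hL).scale fun v hv j => ?_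
      obtain ⟨w, hw, -, h2⟩ := exists_of_mem_rowLattice_scale hv
      rw [show v (Sum.inr j) = 10 ^ 20 * w (Sum.inr j) from congrFun h2 j, pow_succ, mul_comm]
      exact mul_dvd_mul_left _ (hdvd w (hL.rowLattice_le hw) j)
  exact key N 0 (by omega) A hA fun v _ j => by simp

theorem linearIndependent_toCols₁ {l : ℕ} {L : Matrix (Fin l) (Fin n ⊕ Fin m) ℤ}
    (hL : LinearIndependent ℤ L.row) (hB : L.toCols₂ = 0) : LinearIndependent ℤ L.toCols₁.row := by
  let φ : (Fin n → ℤ) →ₗ[ℤ] (Fin n ⊕ Fin m → ℤ) :=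
    { toFun := fun c => Sum.elim c 0
      map_add' := fun x y => by ext (j | j) <;> simp
      map_smul' := fun a x => by ext (j | j) <;> simp }
  refine LinearIndependent.of_comp φ ?_
  convert hL using 1
  ext i (j | j)
  · rfl
  · exact (congrFun (congrFun hB i) j).symm

/-- The lattices that have a basis with entries bounded by `R`. -/
def boundedLattices (n : ℕ) (R : ℝ) : Set (Submodule ℤ (Fin n → ℤ)) :=
  {Λ | ∃ l ≤ n, ∃ C : Matrix (Fin l) (Fin n) ℤ, (∀ i j, |(C i j : ℝ)| ≤ R) ∧ rowLattice C = Λ}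

theorem finite_boundedLattices (n : ℕ) (R : ℝ) : (boundedLattices n R).Finite := by
  have h : (⋃ l ∈ Set.Iic n, rowLattice ''
      {C : Matrix (Fin l) (Fin n) ℤ | ∀ i j, |(C i j : ℝ)| ≤ R}).Finite :=
    (Set.finite_Iic n).biUnion fun l _ => (finite_bounded_matrices (Fin l) R).image _
  refine h.subset ?_
  rintro Λ ⟨l, hl, C, hC, rfl⟩
  exact Set.mem_biUnion (show l ∈ Set.Iic n from hl) ⟨C, hC, rfl⟩

/-- Induction on the number of bounded lattices strictly below Λ. The lattice Λ itself need not be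
bounded, which matters for the initial ℤ^(n+1). -/
theorem boundedLattices_induction (R : ℝ) {P : Submodule ℤ (Fin n → ℤ) → Prop}
    (step : ∀ Λ, (∀ Λ' ∈ boundedLattices n R, Λ' < Λ → P Λ') → P Λ) (Λ) : P Λ := by
  have key : ∀ s : ℕ, ∀ Λ, {Λ' ∈ boundedLattices n R | Λ' < Λ}.ncard = s → P Λ := by
    intro s
    induction s using Nat.strong_induction_on with
    | _ s ih =>
      rintro Λ rfl
      refine step Λ fun Λ' hΛ' hlt => ih _ ?_ Λ' rfl
      refine Set.ncard_lt_ncard ?_ ((finite_boundedLattices n R).subset fun _ h => h.1)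
      exact ⟨fun Λ'' h => ⟨h.1, h.2.trans hlt⟩, fun h => lt_irrefl _ (h ⟨hΛ', hlt⟩).2⟩
  exact key _ Λ rfl

/-- What the end of a reduction returns. -/
theorem LLLWithRemovals.output {k l : ℕ} {b : ℝ} {A : Matrix (Fin k) (Fin n ⊕ Fin m) ℤ}
    {Λ : Submodule ℤ (Fin n → ℤ)} (hA : KernelLE A Λ) {L : Matrix (Fin l) (Fin n ⊕ Fin m) ℤ}
    (hL : LLLWithRemovals b A L) (hB : L.toCols₂ = 0) :
    LinearIndependent ℤ L.toCols₁.row ∧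
      rowLattice L.toCols₁ ∈ boundedLattices n (entryBound b n) ∧ rowLattice L.toCols₁ ≤ Λ := by
  have hind := linearIndependent_toCols₁ hL.2.1.indep hB
  have hl : l ≤ n := by simpa using hind.fintype_card_le_finrank
  refine ⟨hind, ⟨l, hl, _, fun i j => hL.abs_apply_le hl i (Sum.inl j), rfl⟩, ?_⟩
  refine Submodule.span_le.2 ?_
  rintro _ ⟨i, rfl⟩
  exact hA (L i) (hL.rowLattice_le (Submodule.subset_span ⟨i, rfl⟩)) (congrFun hB i)

end Reduction

/-! ### Termination of machines -/

/-- A state from which every run halts without getting stuck. -/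
inductive Halting {σ : Type} (step : σ → σ → Prop) (halted : σ → Prop) : σ → Prop
  | intro (s : σ) (progress : ¬ halted s → ∃ t, step s t)
      (next : ∀ t, step s t → Halting step halted t) : Halting step halted s

theorem Halting.terminates {σ : Type} {step : σ → σ → Prop} {halted : σ → Prop} {s₀ : σ}
    (h : Halting step halted s₀) : Terminates step halted s₀ where
  progress s hs := by
    have hs' : Halting step halted s := by
      induction hs with
      | refl => exact h
      | tail _ hst ih => cases ih with | intro _ _ next => exact next _ hst
    cases hs' with | intro _ progress _ => exact progress
  finite := by
    rintro ⟨run, h0, hrun⟩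
    have key : ∀ s, Halting step halted s → ∀ k, run k ≠ s := by
      intro s hs
      induction hs with
      | intro s _ _ ih =>
        rintro k rfl
        exact ih _ (hrun k) (k + 1) rfl
    exact key s₀ h 0 h0

/-! ### The algorithm halts -/

section Algorithm

variable {f g : ℤ[X]} {b : ℝ}

theorem exists_nextPrime (p : ℕ) : ∃ q : Nat.Primes, NextPrime p q := by
  have h : ∃ r, r.Prime ∧ p < r := by
    obtain ⟨r, hr, hprime⟩ := Nat.exists_infinite_primes (p + 1)
    exact ⟨r, hprime, hr⟩
  classical
  exact ⟨⟨Nat.find h, (Nat.find_spec h).1⟩, Nat.find_spec h, fun r hr => Nat.find_min' h hr⟩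

theorem NextPrime.lt {p : ℕ} {q : Nat.Primes} (h : NextPrime p q) : p < q := h.1.2

theorem NextPrime.lt_of_ne {p : ℕ} {q r : Nat.Primes} (h : NextPrime p q) (hr : p < r)
    (hne : q ≠ r) : (q : ℕ) < r :=
  lt_of_le_of_ne (h.2 ⟨r.2, hr⟩) fun heq => hne (Subtype.ext heq)

theorem bound_pos (hf : Irreducible (toQ f)) {S : ℝ} (hS : 0 < S) : 0 < bound f S := by
  have hn := natDegree_pos_of_irreducible hf
  have hlc : 0 < (f.leadingCoeff : ℝ) ^ 2 := by
    have := leadingCoeff_ne_zero_of_irreducible hf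
    positivity
  have hnorm : 0 < coeffNorm f := Real.sqrt_pos.2 (hlc.trans_le
    (Finset.single_le_sum (f := fun i => (f.coeff i : ℝ) ^ 2) (fun i _ => sq_nonneg _)
      (natDegree_mem_support_of_nonzero (ne_zero_of_irreducible hf))))
  unfold bound
  positivity

/-- Needed so that doubling a really increases it. -/
theorem precision_pos (hb : 0 < b) (e : ℕ) : 0 < precision b e := by
  unfold precision
  rw [Nat.ceil_pos]
  positivity

/-- All stored primes are good, with matching patterns and a factor of degree one. -/
def StoredValid (f g : ℤ[X]) (l : List Nat.Primes) : Prop :=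
  ∀ q ∈ l, IsGood f g q ∧ SameShape f g q ∧ 0 < (ddFactor q f 1).natDegree

theorem StoredValid.store {l : List Nat.Primes} (h : StoredValid f g l) {q : Nat.Primes}
    (good : IsGood f g q) (same : SameShape f g q) : StoredValid f g (store f q l) := by
  unfold FindIso.store
  split_ifs with hq
  · intro r hr
    rcases List.mem_cons.1 hr with rfl | hr
    · exact ⟨good, same, hq⟩
    · exact h r hr
  · exact h

theorem exists_prepared (hg : Irreducible (toQ g)) (b : ℝ) {q : Nat.Primes}
    (same : SameShape f g q) (root : 0 < (ddFactor q f 1).natDegree) {e : ℕ}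
    (C : Matrix (Fin e) (Fin (f.natDegree + 1)) ℤ) : ∃ D, Prepared f g b q C D := by
  obtain ⟨y, hy⟩ := exists_mem_roots_ddFactor_one (ne_zero_of_irreducible hg) (same 1 ▸ root)
  exact ⟨_, (ddFactor q f 1).roots.toList, y, Multiset.coe_toList _, hy, rfl⟩

variable [hfact : Fact (Irreducible (toQ f))]

/-- Every run of FindIsomorphism from the given configuration halts. -/
abbrev Halts (f g : ℤ[X]) [Fact (Irreducible (toQ f))] (b : ℝ) (s : State f) : Prop :=
  Halting (Step f g b) State.Halted s

theorem halts_halt (out : List (NF f)) : Halts f g b (.halt out) :=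
  Halting.intro _ (fun h => absurd ⟨out, rfl⟩ h) fun t ht => by cases ht

/-! #### The loop over the roots -/

/-- The data of the loop over the roots are as they should be. -/
def LoopData.Valid (g : ℤ[X]) (D : LoopData f) : Prop :=
  IsGood f g D.p ∧ (∀ x ∈ D.roots, aeval x f = 0) ∧ aeval D.y g = 0 ∧
    LinearIndependent ℤ D.C₀.row

/-- One root is treated in finitely many steps. -/
theorem halts_loop_cons (D : LoopData f) (hD : D.Valid g) {x : ℚ_[(D.p : ℕ)]}
    {xs : List ℚ_[(D.p : ℕ)]} (hx : D.roots = x :: xs)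
    (hnext : ∀ (a : ℕ) (out : List (NF f)), 0 < a →
      Halts f g b (.loop { D with roots := xs, a := a, out := out } D.C₀))
    {e : ℕ} (C : Matrix (Fin e) (Fin (f.natDegree + 1)) ℤ) (hC : LinearIndependent ℤ C.row)
    (a : ℕ) (ha : 0 < a) : Halts f g b (.loop { D with a := a } C) := by
  obtain ⟨Λ, hΛ⟩ : ∃ Λ, rowLattice C = Λ := ⟨_, rfl⟩
  revert e a
  induction Λ using boundedLattices_induction (entryBound b (f.natDegree + 1)) with
  | step Λ ihΛ =>
  intro e C hC a ha hΛ
  have hroot : aeval x f = 0 := hD.2.1 x (by rw [hx]; exact List.mem_cons_self)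
  -- From the exponent N on, a lattice with several rows must be reduced. With at most one row N is
  -- arbitrary, since a vanishing product then ends the work on this root.
  obtain ⟨N, hN⟩ : ∃ N : ℕ, ∀ a ≥ N, ∀ T, IsRootMatrix f D.p a x D.y T → 1 < e →
      ¬ Vanishes C T (((D.p : ℕ) : ℤ) ^ a) := by
    by_cases he : 1 < e
    · obtain ⟨N, hN⟩ := exists_not_vanishes hD.1 hroot hD.2.2.1 hC he
      exact ⟨N, fun a ha T hT _ => hN a ha T hT⟩
    · exact ⟨0, fun a _ T _ h => absurd h he⟩
  -- The number d bounds the distance from a to N; doubling a ≥ 1 lowers it by at least one. A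
  -- reduction instead moves to a smaller bounded lattice and may start over with any a.
  have key : ∀ d a : ℕ, 0 < a → N ≤ a + d → Halts f g b (.loop { D with a := a } C) := by
    intro d
    induction d using Nat.strong_induction_on with
    | _ d ihd =>
    intro a ha hNa
    refine Halting.intro _ (fun _ => ?_) fun t ht => ?_
    · obtain ⟨T, hT⟩ := exists_isRootMatrix hD.1 a hroot hD.2.2.1
      by_cases hv : Vanishes C T (((D.p : ℕ) : ℤ) ^ a)
      · rcases lt_or_ge 1 e with he | he
        · exact ⟨_, Step.loop_zero _ C x xs hx T hT hv he⟩
        · exact ⟨_, Step.loop_zero_next { D with a := a } C x xs hx T hT hv he⟩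
      · exact ⟨_, Step.loop_reduce { D with a := a } C x xs hx T hT hv⟩
    · cases ht with
      | loop_halt _ _ done => exact absurd (hx.symm.trans done) (List.cons_ne_nil _ _)
      | loop_zero _ _ x' xs' hx' T hT zero he =>
        obtain ⟨rfl, rfl⟩ := List.cons.inj (hx.symm.trans hx')
        have hd : 0 < d := by
          by_contra! h
          exact hN a (by omega) T hT he zero
        exact ihd (d - 1) (by omega) (2 * a) (by omega) (by omega)
      | loop_zero_next _ _ x' xs' hx' T hT zero he =>
        obtain ⟨rfl, rfl⟩ := List.cons.inj (hx.symm.trans hx')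
        exact hnext a _ ha
      | loop_reduce _ _ x' xs' hx' T hT nonzero =>
        refine reduction_induction b (relationLattice C T _)
          (P := fun A => Halts f g b (.loopReduce { D with a := a } A)) ?_ _
          (kernelLE_augment C T _)
        intro k A hA ih
        refine Halting.intro _ (fun _ => ?_) fun t ht => ?_
        · obtain ⟨l, L, hL⟩ := exists_lllWithRemovals b A
          by_cases hB : L.toCols₂ = 0
          · rcases lt_or_ge 1 l with hl | hl
            · exact ⟨_, Step.loop_double _ A L hL hB hl⟩
            · exact ⟨_, Step.loop_next _ A L hL hB hl⟩
          · exact ⟨_, Step.loop_scale _ A L hL hB⟩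
        · cases ht with
          | loop_scale _ _ L hL hB => exact ih L hL hB
          | loop_next _ _ L hL hB hl =>
            have := hnext a (D.out ++ outcome f g _ L.toCols₁) ha
            rw [show xs = D.roots.tail by rw [hx, List.tail_cons]] at this
            exact this
          | loop_double _ _ L hL hB hl =>
            obtain ⟨h1, h2, h3⟩ := LLLWithRemovals.output hA hL hB
            exact ihΛ _ h2 (h3.trans_lt (hΛ ▸ relationLattice_lt nonzero)) L.toCols₁ h1 (2 * a)
              (by omega) rfl
  exact key N a ha (by omega)

theorem halts_loop (D : LoopData f) (hD : D.Valid g) (ha : 0 < D.a) {e : ℕ}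
    (C : Matrix (Fin e) (Fin (f.natDegree + 1)) ℤ) (hC : LinearIndependent ℤ C.row) :
    Halts f g b (.loop D C) := by
  obtain ⟨s, hs⟩ : ∃ s, D.roots.length = s := ⟨_, rfl⟩
  induction s generalizing D e with
  | zero =>
    have hnil : D.roots = [] := List.length_eq_zero_iff.1 hs
    refine Halting.intro _ (fun _ => ⟨_, Step.loop_halt D C hnil⟩) fun t ht => ?_
    cases ht with
    | loop_halt => exact halts_halt _
    | loop_zero _ _ x xs hx => exact absurd (hnil.symm.trans hx).symm (List.cons_ne_nil _ _)
    | loop_zero_next _ _ x xs hx => exact absurd (hnil.symm.trans hx).symm (List.cons_ne_nil _ _)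
    | loop_reduce _ _ x xs hx => exact absurd (hnil.symm.trans hx).symm (List.cons_ne_nil _ _)
  | succ s ih =>
    obtain ⟨x, xs, hx⟩ := List.exists_cons_of_length_eq_add_one hs
    refine halts_loop_cons D hD hx (fun a out ha' => ih _ ?_ ha' D.C₀ hD.2.2.2 ?_) C hC D.a ha
    · exact ⟨hD.1, fun x' hx' => hD.2.1 x' (by rw [hx]; exact List.mem_cons_of_mem _ hx'),
        hD.2.2.1, hD.2.2.2⟩
    · rw [hx] at hs
      simpa using hs

/-! #### The choice of the prime -/

theorem halts_loop_of_prepared (hg : Irreducible (toQ g)) (hb : 0 < b) {q : Nat.Primes}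
    (good : IsGood f g q) {e : ℕ} {C : Matrix (Fin e) (Fin (f.natDegree + 1)) ℤ}
    (hC : LinearIndependent ℤ C.row) {D : LoopData f} (hD : Prepared f g b q C D) :
    Halts f g b (.loop D C) := by
  obtain ⟨xs, y, hxs, hy, rfl⟩ := hD
  refine halts_loop _ ⟨good, fun x hx => ?_, ?_, hC⟩ (precision_pos hb e) C hC
  · refine aeval_eq_zero_of_mem_roots (d := 1) (ne_zero_of_irreducible hfact.out) ?_
    rw [← hxs]
    exact hx
  · exact aeval_eq_zero_of_mem_roots (ne_zero_of_irreducible hg) hy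

/-- Only finitely many primes are bad, while f has roots modulo arbitrarily large primes. -/
theorem exists_isGood_prime_with_root (hg : Irreducible (toQ g)) (p : ℕ) :
    ∃ q : Nat.Primes, p < q ∧ IsGood f g q ∧ 0 < (ddFactor q f 1).natDegree := by
  obtain ⟨B, hB⟩ := exists_bound_not_isGood hfact.out hg
  have hn := natDegree_pos_of_irreducible hfact.out
  obtain ⟨q, hq, hlt, m, hm⟩ := exists_prime_gt_dvd_eval hn (max B p)
  have good : IsGood f g ⟨q, hq⟩ := by
    by_contra h
    exact absurd (hB ⟨q, hq⟩ h) (not_le.2 ((le_max_left _ _).trans_lt hlt))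
  obtain ⟨x, hx⟩ := exists_padic_root hn ⟨q, hq⟩ good.1 good.2.2.1 hm
  exact ⟨⟨q, hq⟩, (le_max_right _ _).trans_lt hlt, good,
    natDegree_ddFactor_one_pos (ne_zero_of_irreducible hfact.out) hx⟩

theorem halts_select_nil (hg : Irreducible (toQ g)) (hb : 0 < b) (d : PreData)
    (hd : d.stored = []) {e : ℕ} (C : Matrix (Fin e) (Fin (f.natDegree + 1)) ℤ)
    (hC : LinearIndependent ℤ C.row) : Halts f g b (.select d C) := by
  obtain ⟨r, hlt, hgood, hroot⟩ := exists_isGood_prime_with_root (f := f) hg d.p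
  -- The prime r is a fixed target ahead of the search: neither a bad prime nor one without root can
  -- be r, so the search cannot step past it and the distance to r decreases.
  obtain ⟨s, hs⟩ : ∃ s, (r : ℕ) - d.p = s := ⟨_, rfl⟩
  induction s using Nat.strong_induction_on generalizing d with
  | _ s ih =>
  refine Halting.intro _ (fun _ => ?_) fun t ht => ?_
  · obtain ⟨q, hq⟩ := exists_nextPrime d.p
    by_cases good : IsGood f g q
    · by_cases same : SameShape f g q
      · rcases Nat.eq_zero_or_pos (ddFactor q f 1).natDegree with h0 | h0
        · exact ⟨_, Step.select_noroot d C hd q hq good same h0⟩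
        · obtain ⟨D, hD⟩ := exists_prepared hg b same h0 C
          exact ⟨_, Step.select_found d C hd q hq good same h0 D hD⟩
      · exact ⟨_, Step.select_differ d C hd q hq good same⟩
    · exact ⟨_, Step.select_bad d C hd q hq good⟩
  · cases ht with
    | select_stored _ _ q hq => rw [hd] at hq; exact absurd hq List.not_mem_nil
    | select_bad _ _ _ q hq bad =>
      have h1 := hq.lt
      have h2 := hq.lt_of_ne hlt (by rintro rfl; exact bad hgood)
      exact ih (r - q) (by omega) { d with p := q } hd h2 rfl
    | select_differ => exact halts_halt _
    | select_noroot _ _ _ q hq good same noroot =>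
      have h1 := hq.lt
      have h2 := hq.lt_of_ne hlt (by rintro rfl; exact hroot.ne' noroot)
      exact ih (r - q) (by omega) { d with p := q } hd h2 rfl
    | select_found _ _ _ q hq good same root D hD => exact halts_loop_of_prepared hg hb good hC hD

theorem halts_select (hg : Irreducible (toQ g)) (hb : 0 < b) (d : PreData)
    (hd : StoredValid f g d.stored) {e : ℕ} (C : Matrix (Fin e) (Fin (f.natDegree + 1)) ℤ)
    (hC : LinearIndependent ℤ C.row) : Halts f g b (.select d C) := by
  by_cases hnil : d.stored = []
  · exact halts_select_nil hg hb d hnil C hC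
  refine Halting.intro _ (fun _ => ?_) fun t ht => ?_
  · obtain ⟨q, hq, hmin⟩ := Set.exists_min_image {q | q ∈ d.stored}
      (fun q => (ddFactor q f 1).natDegree) (List.finite_toSet _)
      (List.exists_mem_of_ne_nil _ hnil)
    obtain ⟨D, hD⟩ := exists_prepared hg b (hd q hq).2.1 (hd q hq).2.2 C
    exact ⟨_, Step.select_stored d C q hq hmin D hD⟩
  · cases ht with
    | select_stored _ _ q hq _ D hD => exact halts_loop_of_prepared hg hb (hd q hq).1 hC hD
    | select_bad _ _ none => exact absurd none hnil
    | select_differ _ _ none => exact absurd none hnil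
    | select_noroot _ _ none => exact absurd none hnil
    | select_found _ _ none => exact absurd none hnil

/-! #### Pre-Processing -/

/-- Lexicographic descent in four quantities: the lattice, which drops at each reduction; 10 -
`cnt`, which drops when CT ≡ 0; 26 - c, which drops at a good prime with m = 1; and B - p, which
drops at a bad prime, B bounding all bad primes. Each event may reset the quantities after it. -/
theorem halts_suitable (hg : Irreducible (toQ g)) (hb : 0 < b) (d : PreData)
    (hd : StoredValid f g d.stored) {e : ℕ} (C : Matrix (Fin e) (Fin (f.natDegree + 1)) ℤ)
    (hC : LinearIndependent ℤ C.row) (c : ℕ) : Halts f g b (.suitable d C c) := by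
  obtain ⟨B, hB⟩ := exists_bound_not_isGood hfact.out hg
  obtain ⟨Λ, hΛ⟩ : ∃ Λ, rowLattice C = Λ := ⟨_, rfl⟩
  revert d e c
  induction Λ using boundedLattices_induction (entryBound b (f.natDegree + 1)) with
  | step Λ ihΛ =>
  intro d hd e C hC c hΛ
  obtain ⟨u, hu⟩ : ∃ u, 10 - d.cnt = u := ⟨_, rfl⟩
  obtain ⟨v, hv⟩ : ∃ v, 26 - c = v := ⟨_, rfl⟩
  obtain ⟨w, hw⟩ : ∃ w, B - d.p = w := ⟨_, rfl⟩
  induction u using Nat.strong_induction_on generalizing v w d c with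
  | _ u ihu =>
  induction v using Nat.strong_induction_on generalizing w d c with
  | _ v ihv =>
  induction w using Nat.strong_induction_on generalizing d with
  | _ w ihw =>
  refine Halting.intro _ (fun _ => ?_) fun t ht => ?_
  · obtain ⟨q, hq⟩ := exists_nextPrime d.p
    by_cases good : IsGood f g q
    · by_cases one : (ddDegrees q f).ncard = 1
      · rcases lt_or_ge 25 (c + 1) with hc | hc
        · exact ⟨_, Step.suitable_galois d C c q hq good one hc⟩
        · exact ⟨_, Step.suitable_one d C c q hq good one hc⟩
      · by_cases same : SameShape f g q
        · obtain ⟨m, T, hT⟩ := exists_isTraceMatrix hg good (precision b e)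
          by_cases hv : Vanishes C T (((q : ℕ) : ℤ) ^ precision b e)
          · rcases lt_or_ge (d.cnt + 1) 10 with hcnt | hcnt
            · exact ⟨_, Step.suitable_zero d C c q hq good one same T hT hv hcnt⟩
            · exact ⟨_, Step.suitable_return d C c q hq good one same T hT hv hcnt⟩
          · exact ⟨_, Step.suitable_reduce d C c q hq good one same T hT hv⟩
        · exact ⟨_, Step.suitable_differ d C c q hq good one same⟩
    · exact ⟨_, Step.suitable_bad d C c q hq good⟩
  · cases ht with
    | suitable_bad _ _ _ q hq bad =>
      have h1 := hq.lt
      have h2 := hB q bad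
      exact ihw (B - q) (by omega) { d with p := q } hd hu rfl
    | suitable_one _ _ _ q hq good one few =>
      exact ihv (26 - (c + 1)) (by omega) { d with p := q } hd (c + 1) hu rfl _ rfl
    | suitable_galois _ _ _ q => exact halts_select hg hb { d with p := q } hd C hC
    | suitable_differ => exact halts_halt _
    | suitable_zero _ _ _ q hq good notone same T hT zero few =>
      exact ihu (10 - (d.cnt + 1)) (by omega) ⟨q, d.cnt + 1, store f q d.stored⟩
        (hd.store good same) 0 rfl _ rfl _ rfl
    | suitable_return _ _ _ q hq good notone same =>
      exact halts_select hg hb _ (hd.store good same) C hC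
    | suitable_reduce _ _ _ q hq good notone same T hT nonzero =>
      refine reduction_induction b (relationLattice C T _)
        (P := fun A => Halts f g b (.preReduce ⟨q, d.cnt, store f q d.stored⟩ A)) ?_ _
        (kernelLE_augment C T _)
      intro k A hA ih
      refine Halting.intro _ (fun _ => ?_) fun t ht => ?_
      · obtain ⟨l, L, hL⟩ := exists_lllWithRemovals b A
        by_cases hB : L.toCols₂ = 0
        · rcases lt_or_ge 1 l with hl | hl
          · exact ⟨_, Step.pre_next _ A L hL hB hl⟩
          · exact ⟨_, Step.pre_halt _ A L hL hB hl⟩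
        · exact ⟨_, Step.pre_scale _ A L hL hB⟩
      · cases ht with
        | pre_scale _ _ L hL hB => exact ih L hL hB
        | pre_halt => exact halts_halt _
        | pre_next _ _ L hL hB hl =>
          obtain ⟨h1, h2, h3⟩ := LLLWithRemovals.output hA hL hB
          exact ihΛ _ h2 (h3.trans_lt (hΛ ▸ relationLattice_lt nonzero)) _
            (hd.store good same) L.toCols₁ h1 0 rfl

end Algorithm

end

end FindIso

/-! ### Termination from the initial configuration -/

theorem mainTheorem7 (f g : Polynomial ℤ)
    [Fact (Irreducible (FindIso.toQ f))] (hg : Irreducible (FindIso.toQ g))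
    (hdeg : f.natDegree = g.natDegree)
    (S : ℝ) (hS : FindIso.rootSum g ≤ S) (hS_pos : 0 < S) :
    FindIso.Terminates (FindIso.Step f g (FindIso.bound f S)) FindIso.State.Halted
      (FindIso.start f) := by
  have hf : Irreducible (FindIso.toQ f) := Fact.out
  -- At the start no prime is stored, so the condition on stored primes is vacuous, and the identity
  -- matrix has independent rows.
  refine (FindIso.halts_suitable hg (FindIso.bound_pos hf hS_pos) _
    (fun q hq => absurd hq List.not_mem_nil) _ ?_ 0).terminates
  exact Matrix.linearIndependent_rows_of_isUnit isUnit_one
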